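/- \textbf{Definitions.} Let $\mathcal C$ be a category. A category is \emph{directed} if it is non-empty, any two objects $s,t$ admit morphisms $u\to s$, $u\to t$ from a common object, and for any parallel $f,g:s\to t$ there is $h:u\to s$ with $fh=gh$. The category $\mathrm{Pro}(\mathcal C)$ has as objects the diagrams $I\to\mathcal C$ with $I$ small and directed, and $\mathrm{Hom}(X,Y)=\lim_s\operatorname{colim}_t\mathrm{Hom}_{\mathcal C}(X_t,Y_s)$. A natural transformation between diagrams with the same index category induces a morphism of $\mathrm{Pro}(\mathcal C)$. We regard $\mathcal C$ as the full subcategory of $\mathrm{Pro}(\mathcal C)$ of simple objects (those indexed by the one-morphism category). A poset $T$ is viewed as a category with a morphism $u\to v$ iff $u\ge v$; it is \emph{cofinite} if every set $\{z\le x\}$ is finite, and has \emph{infinite height} if for every $a$ there is $a'>a$. The category $\overline{\mathrm{Pro}}(\mathcal C)$ has as objects the diagrams $F:A\to\mathcal C$ with $A$ a small cofinite directed poset of infinite height. A 1-morphism from $F:A\to\mathcal C$ to $G:B\to\mathcal C$ is a pair $(\alpha,\phi)$ of a strictly increasing map $\alpha:B\to A$ and a natural transformation $\phi:F\circ\alpha\to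 G$; $(\alpha',\phi')\ge(\alpha,\phi)$ means that $\alpha'(b)\ge\alpha(b)$ and $\phi'_b=\phi_b\circ F(\alpha'(b)\to\alpha(b))$ for all $b$; composition is $(\beta,\psi)\circ(\alpha,\phi)=(\alpha\circ\beta,\psi\circ\phi_\beta)$. Morphisms $F\to G$ in $\overline{\mathrm{Pro}}(\mathcal C)$ are the connected components $[\alpha,\phi]$ of the poset of 1-morphisms. There is a natural functor $i:\overline{\mathrm{Pro}}(\mathcal C)\to\mathrm{Pro}(\mathcal C)$, the identity on diagrams, sending $[\alpha,\phi]$ to the morphism represented by the maps $\phi_b:F(\alpha(b))\to G(b)$. Suppose that $\mathcal C$ has finite limits and let $M$ be a class of morphisms of $\mathcal C$. A natural transformation $X\to Y$ is a \emph{levelwise $M$-map} if all its components are in $M$. A natural transformation of diagrams indexed by a cofinite poset $T$ is a \emph{special $M$-map} if for every $t\in T$ the natural map $X_t\to Y_t\times_{\lim_{s<t}Y_s}\lim_{s<t}X_s$ is in $M$ (for some choice of the fibre product, which is determined only up to isomorphism). In $\mathrm{Pro}(\mathcal C)$, $Lw^{\cong}(M)$ (resp. $Sp^{\cong}(M)$)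 is the class of morphisms isomorphic to one that comes from a levelwise (resp. special) $M$-map of pro-objects. In $\overline{\mathrm{Pro}}(\mathcal C)$, $Lw^{\cong}(M)$ and $Sp^{\cong}(M)$ denote the preimages under $i$ of these classes, and $M$ denotes the preimage of the class of morphisms isomorphic in $\mathrm{Pro}(\mathcal C)$ to a morphism of $M$ between simple objects. Write $R(-)$ for the class of retracts, ${}^{\perp}(-)$, $(-)^{\perp}$ for the classes of morphisms with the left, resp. right, lifting property, $N\perp M$ if every map of $N$ has the left lifting property with respect to every map of $M$, and $\mathrm{Mor}=M\circ N$ if every morphism factors as a map in $N$ followed by a map in $M$. A pair $(N,M)$ is a weak factorization system if $\mathrm{Mor}=M\circ N$, $N={}^{\perp}M$ and $N^{\perp}=M$. \textbf{Proposition.} Let $\mathcal C$ be a category with finite limits, and let $N$ and $M$ be classes of morphisms in $\mathcal C$. Then: \begin{enumerate} \item ${}^{\perp}R(Sp^{\cong}(M))={}^{\perp}Sp^{\cong}(M)={}^{\perp}M$, both in $\mathrm{Pro}(\mathcal C)$ and in $\overline{\mathrm{Pro}}(\mathcal C)$. \item If $\mathrm{Mor}(\mathcal C)=M\circ N$, then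 $\mathrm{Mor}(\overline{\mathrm{Pro}}(\mathcal C))=Sp^{\cong}(M)\circ Lw^{\cong}(N)$. \item If $\mathrm{Mor}(\mathcal C)=M\circ N$ and $N\perp M$, then $(Lw^{\cong}(N),R(Sp^{\cong}(M)))$ is a weak factorization system in $\overline{\mathrm{Pro}}(\mathcal C)$. \end{enumerate} Moreover (2) and (3) also hold if $Lw^{\cong}(N)$ and $Sp^{\cong}(M)$ are replaced by the classes of morphisms isomorphic in $\overline{\mathrm{Pro}}(\mathcal C)$ to some $[\mathrm{id},\phi]$ with $\phi$ a levelwise $N$-map, resp. a special $M$-map, of diagrams indexed by a cofinite directed poset of infinite height. -/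

import Mathlib

open CategoryTheory CategoryTheory.Limits Opposite

universe w v u

/-! ### The pro-category -/

/-- A pro-object of `C`: a diagram `I ⥤ C` indexed by a small directed category `I`.
Mathlib's `IsCofiltered I` says that `I` is non-empty, that any two objects `s`, `t` receive
morphisms from a common object, and that any two parallel morphisms `s ⟶ t` are equalized by some
morphism into `s`. -/
structure ProObj (C : Type u) [Category.{v} C] : Type (max u v (w + 1)) where
  /-- the indexing category -/
  Index : Type w
  [category : SmallCategory.{w} Index]
  [cofiltered : IsCofiltered Index]
  /-- the diagram -/
  diag : Index ⥤ C

attribute [instance] ProObj.category ProObj.cofiltered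

namespace ProObj

variable {C : Type u} [Category.{v} C]

/-- A morphism `X_t ⟶ c` is identified with its restriction along each `X_t' ⟶ X_t`. -/
inductive ColimRel (X : ProObj.{w} C) (c : C) :
    (Σ t : X.Index, (X.diag.obj t ⟶ c)) → (Σ t : X.Index, (X.diag.obj t ⟶ c)) → Prop
  | restrict {t t' : X.Index} (k : t' ⟶ t) (f : X.diag.obj t ⟶ c) :
      ColimRel X c ⟨t, f⟩ ⟨t', X.diag.map k ≫ f⟩

/-- The set `colim_t Hom(X_t, c)`. -/
def ColimHom (X : ProObj.{w} C) (c : C) : Type (max w v) := Quot (ColimRel X c)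

namespace ColimHom

variable {X : ProObj.{w} C}

/-- The class of `f : X_t ⟶ c` in `colim_t Hom(X_t, c)`. -/
def mk {c : C} (t : X.Index) (f : X.diag.obj t ⟶ c) : ColimHom X c := Quot.mk _ ⟨t, f⟩

lemma mk_restrict {c : C} {t t' : X.Index} (k : t' ⟶ t) (f : X.diag.obj t ⟶ c) :
    mk t' (X.diag.map k ≫ f) = mk t f :=
  (Quot.sound (ColimRel.restrict k f)).symm

/-- Postcomposition with `g : c ⟶ d`. -/
def postcomp {c d : C} (g : c ⟶ d) : ColimHom X c → ColimHom X d :=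
  Quot.lift (fun p => mk p.1 (p.2 ≫ g)) (by
    rintro _ _ ⟨k, f⟩
    simpa using (mk_restrict k (f ≫ g)).symm)

@[simp] lemma postcomp_mk {c d : C} (g : c ⟶ d) (t : X.Index) (f : X.diag.obj t ⟶ c) :
    postcomp g (mk t f) = mk t (f ≫ g) := rfl

lemma ind {c : C} {P : ColimHom X c → Prop} (h : ∀ t f, P (mk t f)) (x : ColimHom X c) : P x :=
  Quot.ind (fun p => h p.1 p.2) x

@[simp] lemma postcomp_id {c : C} (x : ColimHom X c) : postcomp (𝟙 c) x = x := by
  induction x using ind with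
  | h t f => simp

lemma postcomp_postcomp {c d e : C} (g : c ⟶ d) (h : d ⟶ e) (x : ColimHom X c) :
    postcomp h (postcomp g x) = postcomp (g ≫ h) x := by
  induction x using ind with
  | h t f => simp

end ColimHom

/-- A morphism of pro-objects: an element of `lim_s colim_t Hom(X_t, Y_s)`. -/
@[ext] structure Hom (X Y : ProObj.{w} C) : Type (max w v) where
  /-- the `s`-coordinate -/
  coord : ∀ s : Y.Index, ColimHom X (Y.diag.obj s)
  compat : ∀ {s s' : Y.Index} (k : s ⟶ s'),
    ColimHom.postcomp (Y.diag.map k) (coord s) = coord s'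

namespace Hom

/-- Precomposition of an element of `colim_s Hom(Y_s, c)` with a morphism `X ⟶ Y`. -/
def precomp {X Y : ProObj.{w} C} (φ : Hom X Y) {c : C} : ColimHom Y c → ColimHom X c :=
  Quot.lift (fun p => ColimHom.postcomp p.2 (φ.coord p.1)) (by
    rintro _ _ ⟨k, f⟩
    simp only [← φ.compat k, ColimHom.postcomp_postcomp])

@[simp] lemma precomp_mk {X Y : ProObj.{w} C} (φ : Hom X Y) {c : C} (s : Y.Index)
    (f : Y.diag.obj s ⟶ c) :
    φ.precomp (ColimHom.mk s f) = ColimHom.postcomp f (φ.coord s) := rfl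

lemma postcomp_precomp {X Y : ProObj.{w} C} (φ : Hom X Y) {c d : C} (g : c ⟶ d)
    (x : ColimHom Y c) :
    ColimHom.postcomp g (φ.precomp x) = φ.precomp (ColimHom.postcomp g x) := by
  induction x using ColimHom.ind with
  | h t f => simp [ColimHom.postcomp_postcomp]

/-- The identity of a pro-object. -/
def id (X : ProObj.{w} C) : Hom X X where
  coord s := ColimHom.mk s (𝟙 _)
  compat k := by simpa using ColimHom.mk_restrict k (𝟙 _)

/-- Composition in the pro-category. -/
def comp {X Y Z : ProObj.{w} C} (φ : Hom X Y) (ψ : Hom Y Z) : Hom X Z where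
  coord s := φ.precomp (ψ.coord s)
  compat k := by rw [postcomp_precomp, ψ.compat k]

end Hom

/-- The category `Pro(C)`. -/
instance : Category.{max w v} (ProObj.{w} C) where
  Hom := Hom
  id := Hom.id
  comp := Hom.comp
  id_comp φ := by
    apply Hom.ext
    funext s
    change (Hom.id _).precomp (φ.coord s) = φ.coord s
    induction φ.coord s using ColimHom.ind with
    | h t f => simp [Hom.id]
  comp_id φ := by
    apply Hom.ext
    funext s
    simp [Hom.comp, Hom.id]
  assoc φ ψ χ := by
    apply Hom.ext
    funext s
    change (φ.comp ψ).precomp (χ.coord s) = φ.precomp (ψ.precomp (χ.coord s))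
    induction χ.coord s using ColimHom.ind with
    | h t f => simp [Hom.comp, Hom.postcomp_precomp]

/-- The morphism of `Pro(C)` determined by a functor `p : J ⥤ I` between the indexing categories
and a natural transformation `p ⋙ X ⟶ Y`. -/
def homOfFunctor {X Y : ProObj.{w} C} (p : Y.Index ⥤ X.Index) (φ : p ⋙ X.diag ⟶ Y.diag) :
    X ⟶ Y :=
  Hom.mk (fun s => ColimHom.mk (p.obj s) (φ.app s)) (fun {s s'} k => by
    rw [ColimHom.postcomp_mk, ← φ.naturality k]
    exact ColimHom.mk_restrict (p.map k) (φ.app s'))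

/-- A diagram `F : I ⥤ C` as an object of `Pro(C)`. -/
abbrev of {I : Type w} [SmallCategory.{w} I] [IsCofiltered I] (F : I ⥤ C) : ProObj.{w} C where
  Index := I
  diag := F

/-- The morphism of `Pro(C)` that comes from a natural transformation between diagrams with the
same indexing category. -/
def ofNatTrans {I : Type w} [SmallCategory.{w} I] [IsCofiltered I] {X Y : I ⥤ C} (φ : X ⟶ Y) :
    of X ⟶ of Y :=
  Hom.mk (fun s => ColimHom.mk s (φ.app s)) (fun {s s'} k => by
    rw [ColimHom.postcomp_mk, ← φ.naturality k]
    exact ColimHom.mk_restrict (X := of X) k (φ.app s'))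

variable (C) in
/-- The embedding of `C` in `Pro(C)` as the simple pro-objects, that is, those indexed by the
category with one object and one morphism. -/
def simple : C ⥤ ProObj.{w} C where
  obj c := of ((Functor.const (Discrete PUnit.{w + 1})).obj c)
  map f := ofNatTrans ((Functor.const (Discrete PUnit.{w + 1})).map f)
  map_comp _ _ := rfl

end ProObj

/-! ### Levelwise and special maps -/

/-- Cofinite posets. -/
class CofinitePoset (T : Type w) [PartialOrder T] : Prop where
  finite_Iic : ∀ x : T, (Set.Iic x).Finite

section Special

variable {C : Type u} [Category.{v} C]

/-- A levelwise `M`-map. -/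
def IsLevelwise (M : MorphismProperty C) {I : Type w} [SmallCategory.{w} I] {X Y : I ⥤ C}
    (φ : X ⟶ Y) : Prop :=
  ∀ i, M (φ.app i)

/- A poset `T` is viewed as a category with a morphism `u ⟶ v` iff `u ≥ v`. In Mathlib's terms this
is the category `Tᵒᵖ`. -/

/-- The inclusion of the elements strictly below `t`. -/
abbrev belowIncl {T : Type w} [PartialOrder T] (t : T) : {s : T // s < t}ᵒᵖ ⥤ Tᵒᵖ :=
  (Subtype.mono_coe (fun s : T => s < t)).functor.op

instance hasLimitsOfShape_below [HasFiniteLimits C] {T : Type w} [PartialOrder T]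
    [CofinitePoset T] (t : T) : HasLimitsOfShape {s : T // s < t}ᵒᵖ C := by
  classical
  have : Finite {s : T // s < t} :=
    ((CofinitePoset.finite_Iic t).subset (fun _ h => le_of_lt h : {s | s < t} ⊆ _)).to_subtype
  have : Finite {s : T // s < t}ᵒᵖ := Finite.of_equiv _ equivToOpposite
  have : Fintype {s : T // s < t}ᵒᵖ := Fintype.ofFinite _
  have : FinCategory {s : T // s < t}ᵒᵖ :=
    { fintypeHom := fun _ _ => Fintype.ofFinite _ }
  infer_instance

/-- The cone with apex `X_t` over the diagram of all `X_s` with `s < t`. -/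
def belowCone {T : Type w} [PartialOrder T] (X : Tᵒᵖ ⥤ C) (t : T) : Cone (belowIncl t ⋙ X) where
  pt := X.obj (op t)
  π :=
    { app := fun s => X.map (homOfLE (le_of_lt s.unop.2)).op
      naturality := fun s _ k =>
        (Category.id_comp _).trans
          (X.map_comp (homOfLE (le_of_lt s.unop.2)).op ((belowIncl t).map k)) }

/-- The natural map `X_t ⟶ lim_{s < t} X_s`. -/
noncomputable def toBelow [HasFiniteLimits C] {T : Type w} [PartialOrder T] [CofinitePoset T]
    (X : Tᵒᵖ ⥤ C) (t : T) : X.obj (op t) ⟶ limit (belowIncl t ⋙ X) :=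
  limit.lift _ (belowCone X t)

lemma toBelow_π [HasFiniteLimits C] {T : Type w} [PartialOrder T] [CofinitePoset T]
    (X : Tᵒᵖ ⥤ C) (t : T) (s : {s : T // s < t}ᵒᵖ) :
    toBelow X t ≫ limit.π (belowIncl t ⋙ X) s = X.map (homOfLE (le_of_lt s.unop.2)).op :=
  limit.lift_π _ _

/-- The natural map `lim_{s < t} X_s ⟶ lim_{s < t} Y_s`. -/
noncomputable def belowMap [HasFiniteLimits C] {T : Type w} [PartialOrder T] [CofinitePoset T]
    {X Y : Tᵒᵖ ⥤ C} (φ : X ⟶ Y) (t : T) :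
    limit (belowIncl t ⋙ X) ⟶ limit (belowIncl t ⋙ Y) :=
  limMap (Functor.whiskerLeft (belowIncl t) φ)

lemma toBelow_comp_belowMap [HasFiniteLimits C] {T : Type w} [PartialOrder T] [CofinitePoset T]
    {X Y : Tᵒᵖ ⥤ C} (φ : X ⟶ Y) (t : T) :
    φ.app (op t) ≫ toBelow Y t = toBelow X t ≫ belowMap φ t := by
  apply limit.hom_ext
  intro s
  rw [Category.assoc, Category.assoc, toBelow_π, belowMap, limMap_π, ← Category.assoc, toBelow_π]
  exact (φ.naturality _).symm

/-- A special `M`-map: for every `t` the natural map from `X_t` to the fibre product of `Y_t` and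
`lim_{s < t} X_s` over `lim_{s < t} Y_s` is in `M`. A fibre product is only determined up to
isomorphism, and `M` need not be closed under isomorphism; the condition is that `M` contains the
natural map into some fibre product `P`. -/
def IsSpecial [HasFiniteLimits C] (M : MorphismProperty C) {T : Type w} [PartialOrder T]
    [CofinitePoset T] {X Y : Tᵒᵖ ⥤ C} (φ : X ⟶ Y) : Prop :=
  ∀ t : T, ∃ (P : C) (p : P ⟶ Y.obj (op t)) (q : P ⟶ limit (belowIncl t ⋙ X))
    (h : IsPullback p q (toBelow Y t) (belowMap φ t)),
    M (h.lift (φ.app (op t)) (toBelow X t) (toBelow_comp_belowMap φ t))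

end Special

namespace ProObj

variable {C : Type u} [Category.{v} C]

/-- The class `Lw^≅(M)` in `Pro(C)`: morphisms isomorphic, in the category of arrows, to one that
comes from a levelwise `M`-map. -/
def Lw (M : MorphismProperty C) : MorphismProperty (ProObj.{w} C) := fun _ _ f =>
  ∃ (I : Type w) (_ : SmallCategory.{w} I) (_ : IsCofiltered I) (X Y : I ⥤ C) (φ : X ⟶ Y),
    IsLevelwise M φ ∧ Nonempty (Arrow.mk f ≅ Arrow.mk (ofNatTrans φ))

/-- The class `Sp^≅(M)` in `Pro(C)`: morphisms isomorphic, in the category of arrows, to one that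
comes from a special `M`-map (indexed by a cofinite directed set). -/
def Sp [HasFiniteLimits C] (M : MorphismProperty C) : MorphismProperty (ProObj.{w} C) :=
  fun _ _ f =>
  ∃ (T : Type w) (_ : PartialOrder T) (_ : CofinitePoset T) (_ : Nonempty T)
    (_ : IsDirectedOrder T) (X Y : Tᵒᵖ ⥤ C) (φ : X ⟶ Y),
    IsSpecial M φ ∧ Nonempty (Arrow.mk f ≅ Arrow.mk (ofNatTrans φ))

/-- `M` as a class of morphisms of `Pro(C)`, through the simple pro-objects
(and up to isomorphism). -/
def ofBase (M : MorphismProperty C) : MorphismProperty (ProObj.{w} C) := M.map (simple.{w} C)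

end ProObj

/-! ### The model of the pro-category indexed by cofinite directed sets of infinite height -/

/-- A diagram indexed by a cofinite directed set of infinite height
(`NoMaxOrder`: every `a` has some `a' > a`). -/
structure BarPro (C : Type u) [Category.{v} C] : Type (max u v (w + 1)) where
  /-- the indexing poset -/
  Index : Type w
  [order : PartialOrder Index]
  [cofinite : CofinitePoset Index]
  [nonempty : Nonempty Index]
  [directed : IsDirectedOrder Index]
  [infiniteHeight : NoMaxOrder Index]
  /-- the diagram -/
  diag : Indexᵒᵖ ⥤ C

attribute [instance] BarPro.order BarPro.cofinite BarPro.nonempty BarPro.directed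
  BarPro.infiniteHeight

namespace BarPro

variable {C : Type u} [Category.{v} C]

/-- 1-morphisms: a strictly increasing function `α` from the index set of `G` to that of `F`, and a
natural transformation `F ∘ α ⟶ G`. -/
@[ext] structure OneHom (F G : BarPro.{w} C) : Type (max w v) where
  /-- the function on indices -/
  fn : G.Index → F.Index
  strictMono : StrictMono fn
  /-- the natural transformation -/
  nat : strictMono.monotone.functor.op ⋙ F.diag ⟶ G.diag

namespace OneHom

/-- The component `F(α(b)) ⟶ G(b)`. -/
abbrev app {F G : BarPro.{w} C} (f : OneHom F G) (b : G.Index) :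
    F.diag.obj (op (f.fn b)) ⟶ G.diag.obj (op b) :=
  f.nat.app (op b)

lemma app_naturality {F G : BarPro.{w} C} (f : OneHom F G) {b b' : G.Index} (k : b ≤ b') :
    F.diag.map (homOfLE (f.strictMono.monotone k)).op ≫ f.app b =
      f.app b' ≫ G.diag.map (homOfLE k).op :=
  f.nat.naturality (homOfLE k).op

/-- `(α, φ) ≤ (α', φ')` iff `α ≤ α'` and each `φ'_b` is the restriction of `φ_b`. -/
instance (F G : BarPro.{w} C) : PartialOrder (OneHom F G) where
  le f f' := ∃ h : ∀ b, f.fn b ≤ f'.fn b,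
    ∀ b, F.diag.map (homOfLE (h b)).op ≫ f.app b = f'.app b
  le_refl f := ⟨fun _ => le_rfl, fun b => by
    have : (homOfLE (le_refl (f.fn b))).op = 𝟙 _ := rfl
    rw [this]; simp⟩
  le_trans f g k := by
    rintro ⟨h, e⟩ ⟨h', e'⟩
    refine ⟨fun b => (h b).trans (h' b), fun b => ?_⟩
    rw [← e' b, ← e b, ← Category.assoc, ← Functor.map_comp]
    rfl
  le_antisymm f g := by
    rintro ⟨h, e⟩ ⟨h', _⟩
    obtain ⟨α, hα, φ⟩ := f
    obtain ⟨β, hβ, ψ⟩ := g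
    obtain rfl : α = β := funext fun b => le_antisymm (h b) (h' b)
    have key : φ = ψ := by
      apply NatTrans.ext
      funext b
      have e1 := e b.unop
      have : (homOfLE (h b.unop)).op = 𝟙 _ := rfl
      rw [this] at e1
      simpa using e1
    rw [key]

/-- The identity 1-morphism. -/
def id (F : BarPro.{w} C) : OneHom F F where
  fn := fun a => a
  strictMono := strictMono_id
  nat := { app := fun _ => 𝟙 _
           naturality := fun _ _ _ => (Category.comp_id _).trans (Category.id_comp _).symm }

/-- Composition of 1-morphisms: `(β, ψ) ∘ (α, φ) = (α ∘ β, ψ ∘ φ_β)`. -/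
def comp {F G H : BarPro.{w} C} (f : OneHom F G) (g : OneHom G H) : OneHom F H where
  fn := fun c => f.fn (g.fn c)
  strictMono := f.strictMono.comp g.strictMono
  nat :=
    { app := fun c => f.app (g.fn c.unop) ≫ g.app c.unop
      naturality := fun c c' k => by
        have h1 := f.app_naturality (g.strictMono.monotone k.unop.le)
        have h2 := g.app_naturality k.unop.le
        have h3 : H.diag.map k = H.diag.map (homOfLE k.unop.le).op := rfl
        rw [h3]
        refine Eq.trans (Category.assoc _ _ _).symm ?_
        refine Eq.trans (congrArg (· ≫ g.app c'.unop) h1) ?_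
        refine Eq.trans (Category.assoc _ _ _) ?_
        refine Eq.trans (congrArg (f.app (g.fn c.unop) ≫ ·) h2) ?_
        exact (Category.assoc _ _ _).symm }

lemma comp_le_comp_left {F G H : BarPro.{w} C} (f : OneHom F G) {g g' : OneHom G H} (h : g ≤ g') :
    f.comp g ≤ f.comp g' := by
  obtain ⟨h, e⟩ := h
  refine ⟨fun c => f.strictMono.monotone (h c), fun c => ?_⟩
  change _ ≫ f.app (g.fn c) ≫ g.app c = f.app (g'.fn c) ≫ g'.app c
  rw [← e c]
  refine Eq.trans (Category.assoc _ _ _).symm ?_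
  refine Eq.trans (congrArg (· ≫ g.app c) (f.app_naturality (h c))) ?_
  exact Category.assoc _ _ _

lemma comp_le_comp_right {F G H : BarPro.{w} C} {f f' : OneHom F G} (h : f ≤ f') (g : OneHom G H) :
    f.comp g ≤ f'.comp g := by
  obtain ⟨h, e⟩ := h
  refine ⟨fun c => h (g.fn c), fun c => ?_⟩
  change _ ≫ f.app (g.fn c) ≫ g.app c = f'.app (g.fn c) ≫ g.app c
  rw [← e (g.fn c)]
  exact (Category.assoc _ _ _).symm

end OneHom

/-- Morphisms of the homotopy category: connected components of the poset of 1-morphisms. -/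
def Hom (F G : BarPro.{w} C) : Type (max w v) :=
  Quot (fun f g : OneHom F G => f ≤ g)

/-- The component of a 1-morphism. -/
def Hom.mk {F G : BarPro.{w} C} (f : OneHom F G) : Hom F G := Quot.mk _ f

/-- The category obtained from the 2-category of diagrams, 1-morphisms and their partial order by
identifying 1-morphisms that are related by a 2-morphism. -/
instance : Category.{max w v} (BarPro.{w} C) where
  Hom := Hom
  id F := Hom.mk (OneHom.id F)
  comp := Quot.map₂ OneHom.comp (fun f _ _ h => OneHom.comp_le_comp_left f h)
    (fun _ _ g h => OneHom.comp_le_comp_right h g)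
  id_comp := by
    rintro F G ⟨f⟩
    refine congrArg (Quot.mk _) (OneHom.ext rfl (heq_of_eq ?_))
    apply NatTrans.ext
    funext b
    exact Category.id_comp _
  comp_id := by
    rintro F G ⟨f⟩
    refine congrArg (Quot.mk _) (OneHom.ext rfl (heq_of_eq ?_))
    apply NatTrans.ext
    funext b
    exact Category.comp_id _
  assoc := by
    rintro F G H K ⟨f⟩ ⟨g⟩ ⟨h⟩
    refine congrArg (Quot.mk _) (OneHom.ext rfl (heq_of_eq ?_))
    apply NatTrans.ext
    funext b
    exact Category.assoc _ _ _

/-- A diagram as an object. -/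
abbrev of {A : Type w} [PartialOrder A] [CofinitePoset A] [Nonempty A] [IsDirectedOrder A]
    [NoMaxOrder A] (F : Aᵒᵖ ⥤ C) : BarPro.{w} C where
  Index := A
  diag := F

/-- The morphism `[id, φ]` of a natural transformation between diagrams with the same index set. -/
def ofNatTrans {A : Type w} [PartialOrder A] [CofinitePoset A] [Nonempty A] [IsDirectedOrder A]
    [NoMaxOrder A] {X Y : Aᵒᵖ ⥤ C} (φ : X ⟶ Y) : of X ⟶ of Y :=
  Hom.mk (F := of X) (G := of Y)
    { fn := fun a => a
      strictMono := strictMono_id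
      nat := { app := fun a => φ.app a
               naturality := fun _ _ k => φ.naturality k } }

/-- The morphism of `Pro(C)` induced by a 1-morphism. -/
def OneHom.toPro {F G : BarPro.{w} C} (f : OneHom F G) :
    ProObj.of F.diag ⟶ ProObj.of G.diag :=
  ProObj.homOfFunctor (X := ProObj.of F.diag) (Y := ProObj.of G.diag)
    f.strictMono.monotone.functor.op f.nat

lemma OneHom.toPro_eq_of_le {F G : BarPro.{w} C} {f g : OneHom F G} (h : f ≤ g) :
    f.toPro = g.toPro := by
  obtain ⟨h, e⟩ := h
  apply ProObj.Hom.ext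
  funext b
  refine (ProObj.ColimHom.mk_restrict (X := ProObj.of F.diag)
    (homOfLE (h b.unop)).op (f.app b.unop)).symm.trans ?_
  exact congrArg (ProObj.ColimHom.mk (X := ProObj.of F.diag) (op (g.fn b.unop))) (e b.unop)

variable (C) in
/-- The natural functor `i` to `Pro(C)`. -/
def toPro : BarPro.{w} C ⥤ ProObj.{w} C where
  obj F := ProObj.of F.diag
  map {F G} f := Quot.lift (fun f : OneHom F G => f.toPro) (fun _ _ h => OneHom.toPro_eq_of_le h) f
  map_id _ := rfl
  map_comp := by
    rintro F G H ⟨f⟩ ⟨g⟩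
    rfl

/-- `Lw^≅(M)` as the preimage of the class of the same name in `Pro(C)`. -/
def Lw (M : MorphismProperty C) : MorphismProperty (BarPro.{w} C) :=
  (ProObj.Lw.{w} M).inverseImage (toPro.{w} C)

/-- `Sp^≅(M)` as the preimage of the class of the same name in `Pro(C)`. -/
def Sp [HasFiniteLimits C] (M : MorphismProperty C) : MorphismProperty (BarPro.{w} C) :=
  (ProObj.Sp.{w} M).inverseImage (toPro.{w} C)

/-- `M` as a class of morphisms, through the identification with `Pro(C)`. -/
def ofBase (M : MorphismProperty C) : MorphismProperty (BarPro.{w} C) :=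
  (ProObj.ofBase.{w} M).inverseImage (toPro.{w} C)

/-- Morphisms isomorphic to some `[id, φ]` with `φ` a levelwise `M`-map. -/
def LwInternal (M : MorphismProperty C) : MorphismProperty (BarPro.{w} C) := fun _ _ f =>
  ∃ (A : Type w) (_ : PartialOrder A) (_ : CofinitePoset A) (_ : Nonempty A)
    (_ : IsDirectedOrder A) (_ : NoMaxOrder A) (X Y : Aᵒᵖ ⥤ C) (φ : X ⟶ Y),
    IsLevelwise M φ ∧ Nonempty (Arrow.mk f ≅ Arrow.mk (ofNatTrans φ))

/-- Morphisms isomorphic to some `[id, φ]` with `φ` a special `M`-map. -/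
def SpInternal [HasFiniteLimits C] (M : MorphismProperty C) : MorphismProperty (BarPro.{w} C) :=
  fun _ _ f =>
  ∃ (A : Type w) (_ : PartialOrder A) (_ : CofinitePoset A) (_ : Nonempty A)
    (_ : IsDirectedOrder A) (_ : NoMaxOrder A) (X Y : Aᵒᵖ ⥤ C) (φ : X ⟶ Y),
    IsSpecial M φ ∧ Nonempty (Arrow.mk f ≅ Arrow.mk (ofNatTrans φ))

end BarPro

/-! The functor `colim_t Hom(B_t, -)` preserves finite limits, because filtered colimits of sets
commute with them (`ColimHom.exists_postcomp_eq_of_isLimit`, `ColimHom.ext_of_isLimit`). Hence a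
lift against a special `M`-map can be built by recursion over its cofinite index poset. The lifts
chosen below `t` define an element over `lim_{s < t} X_s`; together with the given map to `Y_t` this
is an element over the fibre product, and the lift at `t` is a lift against one map of `M`
(`hasLiftingProperty_ofNatTrans_of_isSpecial`). Conversely, a map of simple objects is special over
a one-point poset, and retracts do not change left lifting classes. This gives (1) in `Pro(C)`. It
passes to the cofinite model because `BarPro.toPro` is fully faithful and constant diagrams on the
natural numbers represent simple objects.

For (2), a 1-morphism `(α, φ)` is replaced by a natural transformation over the poset of pairs `(a,
b)` with `α b ≤ a`. One then factors level by level: at `t`, the comparison map into the fibre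
product of `Y_t` and `lim_{s < t} Z_s` is factored in `C`, where the `Z_s` below `t` are already
known. `exists_isLevelwise_comp_isSpecial` realizes this as a colimit of partial factorizations that
stabilizes at each index.

For (3), `N ⊥ M` gives `Lw(N) ⊆ ⊥M`. The converse inclusion is `BarPro.ofBase_llp_le_LwInternal`: if
`φ : X ⟶ Y` lifts against `M`, factor each `φ_a` as `X_a ⟶ Z_a ⟶ Y_a`; a lift gives `Y_{α a} ⟶ Z_a`
for some `α a > a`. After the order is thinned out, the `Z_a` form a diagram isomorphic to `Y` which
receives a levelwise `N`-map from `X`. So the left class equals `⊥M`, and the retract argument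
finishes the proof. -/

namespace ProObj

variable {C : Type u} [Category.{v} C]

/-! ### Filtered colimits of Hom sets and finite limits -/

namespace ColimHom

variable {X : ProObj.{w} C}

/-- The relation on the right is already an equivalence relation: transitivity completes two arrows
with a common target to a commutative square, which is possible because the index category is
cofiltered. -/
lemma mk_eq_mk_iff {c : C} {t t' : X.Index} (f : X.diag.obj t ⟶ c) (f' : X.diag.obj t' ⟶ c) :
    mk t f = mk t' f' ↔
      ∃ (s : X.Index) (k : s ⟶ t) (k' : s ⟶ t'), X.diag.map k ≫ f = X.diag.map k' ≫ f' := by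
  constructor
  · intro h
    have key : ∀ p q : (Σ t : X.Index, (X.diag.obj t ⟶ c)),
        Relation.EqvGen (ColimRel X c) p q →
        ∃ (s : X.Index) (k : s ⟶ p.1) (k' : s ⟶ q.1),
          X.diag.map k ≫ p.2 = X.diag.map k' ≫ q.2 := by
      intro p q hpq
      induction hpq with
      | rel p q h =>
        obtain ⟨k, f⟩ := h
        exact ⟨_, k, 𝟙 _, by simp⟩
      | refl p => exact ⟨_, 𝟙 _, 𝟙 _, rfl⟩
      | symm p q _ ih =>
        obtain ⟨s, k, k', e⟩ := ih
        exact ⟨s, k', k, e.symm⟩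
      | trans p q r _ _ ih₁ ih₂ =>
        obtain ⟨s₁, k₁, k₁', e₁⟩ := ih₁
        obtain ⟨s₂, k₂, k₂', e₂⟩ := ih₂
        obtain ⟨s, l₁, l₂, e⟩ := IsCofiltered.cospan k₁' k₂
        refine ⟨s, l₁ ≫ k₁, l₂ ≫ k₂', ?_⟩
        rw [Functor.map_comp, Functor.map_comp, Category.assoc, Category.assoc, e₁, ← e₂,
          ← Category.assoc, ← Category.assoc, ← Functor.map_comp, ← Functor.map_comp, e]
    exact key ⟨t, f⟩ ⟨t', f'⟩ (Quot.eqvGen_exact h)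
  · rintro ⟨s, k, k', e⟩
    rw [← mk_restrict k f, e, mk_restrict]

lemma mk_eq_mk_iff_exists_map {c : C} {t : X.Index} (f f' : X.diag.obj t ⟶ c) :
    mk t f = mk t f' ↔ ∃ (s : X.Index) (k : s ⟶ t), X.diag.map k ≫ f = X.diag.map k ≫ f' := by
  rw [mk_eq_mk_iff]
  constructor
  · rintro ⟨s, k, k', e⟩
    refine ⟨_, IsCofiltered.eqHom k k' ≫ k, ?_⟩
    rw [Functor.map_comp, Category.assoc, e, ← Category.assoc, ← Functor.map_comp,
      ← IsCofiltered.eq_condition, Functor.map_comp]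
  · rintro ⟨s, k, e⟩
    exact ⟨s, k, k, e⟩

lemma exists_rep {c : C} (x : ColimHom X c) :
    ∃ (t : X.Index) (f : X.diag.obj t ⟶ c), mk t f = x := by
  induction x using ind with
  | h t f => exact ⟨t, f, rfl⟩

/-- Finitely many elements have representatives with a common index. -/
lemma exists_common_rep {ι : Type*} [Finite ι] {c : ι → C} (x : ∀ i, ColimHom X (c i)) :
    ∃ (t : X.Index) (f : ∀ i, X.diag.obj t ⟶ c i), ∀ i, mk t (f i) = x i := by
  classical
  choose t f hf using fun i => exists_rep (x i)
  have := Fintype.ofFinite ι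
  obtain ⟨s, hs⟩ := IsCofiltered.inf_objs_exists (Finset.univ.image t)
  have k : ∀ i, s ⟶ t i := fun i => (hs (Finset.mem_image_of_mem _ (Finset.mem_univ i))).some
  exact ⟨s, fun i => X.diag.map (k i) ≫ f i, fun i => by rw [mk_restrict, hf]⟩

/-- Finitely many equalities hold at a common index. -/
lemma exists_map_comp_eq {ι : Type*} [Finite ι] {c : ι → C} {t : X.Index}
    (f f' : ∀ i, X.diag.obj t ⟶ c i) (h : ∀ i, mk t (f i) = mk t (f' i)) :
    ∃ (s : X.Index) (k : s ⟶ t), ∀ i, X.diag.map k ≫ f i = X.diag.map k ≫ f' i := by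
  choose r k hk using fun i => (mk_eq_mk_iff_exists_map _ _).1 (h i)
  obtain ⟨s, l, l', e⟩ := IsCofiltered.wideCospan k
  refine ⟨s, l, fun i => ?_⟩
  rw [← e i, Functor.map_comp, Category.assoc, Category.assoc, hk]

section Limits

variable {J : Type*} [Category* J] [Finite J] {K : J ⥤ C} {c : Cone K}

/-- Uniqueness half of the commutation of filtered colimits with finite limits: the finitely many
equalities of legs all hold at one index, where the limit property applies. -/
lemma ext_of_isLimit (hc : IsLimit c) {x y : ColimHom X c.pt}
    (h : ∀ j, postcomp (c.π.app j) x = postcomp (c.π.app j) y) : x = y := by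
  -- The two elements are packed into a family over `Bool` so that they get representatives at the
  -- same index.
  obtain ⟨t, f, hf⟩ := exists_common_rep (ι := Bool) (c := fun _ => c.pt) (fun b => cond b x y)
  obtain rfl := hf true
  obtain rfl := hf false
  obtain ⟨s, k, e⟩ := exists_map_comp_eq (fun j => f true ≫ c.π.app j)
    (fun j => f false ≫ c.π.app j) h
  rw [mk_eq_mk_iff_exists_map]
  exact ⟨s, k, hc.hom_ext fun j => by simpa using e j⟩

/-- Existence half: there are finitely many objects and arrows in `J`, so at a late enough index the
compatibilities hold strictly in `C`, and the representatives form a cone. -/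
lemma exists_postcomp_eq_of_isLimit [∀ i j : J, Finite (i ⟶ j)] (hc : IsLimit c)
    (x : ∀ j, ColimHom X (K.obj j))
    (hx : ∀ (j j' : J) (k : j ⟶ j'), postcomp (K.map k) (x j) = x j') :
    ∃ y : ColimHom X c.pt, ∀ j, postcomp (c.π.app j) y = x j := by
  obtain ⟨t, f, hf⟩ := exists_common_rep x
  obtain ⟨s, l, e⟩ := exists_map_comp_eq (ι := Σ j j' : J, (j ⟶ j'))
    (fun k => f k.1 ≫ K.map k.2.2) (fun k => f k.2.1) (fun k => by
      rw [hf, ← hx _ _ k.2.2, ← hf, postcomp_mk])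
  let c' : Cone K :=
    { pt := X.diag.obj s
      π := { app := fun j => X.diag.map l ≫ f j
             naturality := fun j j' k => by
              have := e ⟨j, j', k⟩
              simp only [Category.assoc] at this ⊢
              rw [this]
              exact Category.id_comp _ } }
  refine ⟨mk s (hc.lift c'), fun j => ?_⟩
  rw [postcomp_mk, hc.fac, ← hf j]
  exact mk_restrict l (f j)

end Limits

section Pullback

variable {P a b c : C} {p : P ⟶ a} {q : P ⟶ b} {f : a ⟶ c} {g : b ⟶ c}

lemma ext_of_isPullback (h : IsPullback p q f g) {x y : ColimHom X P}
    (hp : postcomp p x = postcomp p y) (hq : postcomp q x = postcomp q y) : x = y := by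
  apply ext_of_isLimit h.isLimit
  rintro (_ | _ | _)
  · have e : postcomp (p ≫ f) x = postcomp (p ≫ f) y := by
      rw [← postcomp_postcomp, hp, postcomp_postcomp]
    exact e
  · exact hp
  · exact hq

lemma exists_postcomp_eq_of_isPullback (h : IsPullback p q f g) (x : ColimHom X a)
    (y : ColimHom X b) (e : postcomp f x = postcomp g y) :
    ∃ z : ColimHom X P, postcomp p z = x ∧ postcomp q z = y := by
  obtain ⟨t, u, hu⟩ := exists_common_rep (ι := Bool) (c := fun i => cond i a b)
    (fun i => match i with | true => x | false => y)
  obtain rfl := hu true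
  obtain rfl := hu false
  obtain ⟨s, k, hk⟩ := (mk_eq_mk_iff_exists_map (c := c) (u true ≫ f) (u false ≫ g)).1 e
  refine ⟨mk s (h.lift (X.diag.map k ≫ u true) (X.diag.map k ≫ u false) (by simpa using hk)), ?_⟩
  rw [postcomp_mk, postcomp_mk, h.lift_fst, h.lift_snd]
  exact ⟨mk_restrict k _, mk_restrict k _⟩

end Pullback

end ColimHom

lemma hom_ext {X Y : ProObj.{w} C} {φ ψ : X ⟶ Y} (h : ∀ s, Hom.coord φ s = Hom.coord ψ s) :
    φ = ψ :=
  Hom.ext (funext h)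

/-- Morphisms to a simple pro-object. -/
def homSimpleEquiv {X : ProObj.{w} C} {c : C} : (X ⟶ (simple.{w} C).obj c) ≃ ColimHom X c where
  toFun φ := Hom.coord φ ⟨⟨⟩⟩
  invFun x := Hom.mk (fun _ => x) (fun _ => ColimHom.postcomp_id x)
  left_inv _ := hom_ext fun _ => rfl
  right_inv _ := rfl

/-- Lifting against a map of simple objects becomes a statement about elements of filtered colimits
of Hom sets, the form in which it is used throughout. -/
lemma hasLiftingProperty_simple_map_iff {A B : ProObj.{w} C} (i : A ⟶ B) {c d : C} (m : c ⟶ d) :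
    HasLiftingProperty i ((simple C).map m) ↔
      ∀ (x : ColimHom A c) (y : ColimHom B d), ColimHom.postcomp m x = Hom.precomp i y →
        ∃ z : ColimHom B c, Hom.precomp i z = x ∧ ColimHom.postcomp m z = y := by
  constructor
  · intro h x y e
    have sq : CommSq (homSimpleEquiv.symm x) i ((simple C).map m) (homSimpleEquiv.symm y) :=
      ⟨homSimpleEquiv.injective e⟩
    exact ⟨homSimpleEquiv sq.lift, congrArg homSimpleEquiv sq.fac_left,
      congrArg homSimpleEquiv sq.fac_right⟩
  · intro h
    refine ⟨fun {x y} sq => ?_⟩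
    obtain ⟨z, h₁, h₂⟩ := h (homSimpleEquiv x) (homSimpleEquiv y) (congrArg homSimpleEquiv sq.w)
    exact ⟨⟨homSimpleEquiv.symm z, homSimpleEquiv.injective h₁, homSimpleEquiv.injective h₂⟩⟩

lemma ofBase_llp_iff (M : MorphismProperty C) {A B : ProObj.{w} C} (i : A ⟶ B) :
    (ofBase.{w} M).llp i ↔
      ∀ {c d : C} (m : c ⟶ d), M m → HasLiftingProperty i ((simple C).map m) := by
  constructor
  · intro h c d m hm
    exact h _ (MorphismProperty.map_mem_map _ _ _ hm)
  · rintro h X Y f ⟨c, d, m, hm, ⟨e⟩⟩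
    have := h m hm
    exact HasLiftingProperty.of_arrow_iso_right i e

end ProObj

/-! ### Recursive choices over cofinite posets -/

/-- Dependent choice along a well-founded relation: if each compatible family of good elements
below `a` can be extended to `a`, then there is a compatible family of good elements. -/
lemma exists_compatible_family {α : Type*} [Preorder α] [WellFoundedLT α] {β : α → Type*}
    (P : ∀ a, β a → Prop) (R : ∀ a b : α, β b → β a → Prop)
    (step : ∀ (a : α) (x : ∀ b, b < a → β b), (∀ b hb, P b (x b hb)) →
      (∀ b hb c (hc : c < b), R b c (x c (hc.trans hb)) (x b hb)) →
      ∃ y : β a, P a y ∧ ∀ b hb, R a b (x b hb) y) :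
    ∃ x : ∀ a, β a, (∀ a, P a (x a)) ∧ ∀ a b, b < a → R a b (x b) (x a) := by
  classical
  -- Well-founded recursion cannot assume that the earlier values are good and compatible, so it
  -- takes values in `Option`, with `none` when no extension exists; `key` shows that `none` never
  -- occurs.
  let G : ∀ a, (∀ b, b < a → Option (β b)) → Option (β a) := fun a o =>
    if h : ∃ (x : ∀ b, b < a → β b) (y : β a), (∀ b hb, o b hb = some (x b hb)) ∧ P a y ∧
      ∀ b hb, R a b (x b hb) y then some h.choose_spec.choose else none
  let F : ∀ a, Option (β a) := WellFoundedLT.fix G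
  have hF : ∀ a, F a = G a fun b _ => F b := fun a => WellFoundedLT.fix_eq G a
  have key : ∀ a, ∃ y, F a = some y ∧ P a y ∧ ∀ b, b < a → ∀ z, F b = some z → R a b z y := by
    intro a
    induction a using WellFoundedLT.induction with
    | ind a ih =>
      choose x hx hP hR using ih
      obtain ⟨y, hy⟩ := step a x hP
        (fun b hb c hc => hR b hb c hc _ (hx c (hc.trans hb)))
      have h : ∃ (x : ∀ b, b < a → β b) (y : β a), (∀ b hb, F b = some (x b hb)) ∧ P a y ∧
        ∀ b hb, R a b (x b hb) y := ⟨x, y, hx, hy⟩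
      refine ⟨h.choose_spec.choose, ?_, h.choose_spec.choose_spec.2.1, ?_⟩
      · rw [hF]
        exact dif_pos h
      · intro b hb z hz
        rw [h.choose_spec.choose_spec.1 b hb] at hz
        obtain rfl := Option.some_injective _ hz
        exact h.choose_spec.choose_spec.2.2 b hb
  choose x hx hP hR using key
  exact ⟨x, hP, fun a b hb => hR a b hb _ (hx b)⟩

namespace CofinitePoset

variable {T : Type w} [PartialOrder T] [CofinitePoset T]

-- The number of elements of `Iic t` serves as a height function: it gives well-foundedness here and
-- the levels of the inductive factorization later.
variable (T) in
lemma ncard_Iic_strictMono : StrictMono fun t : T => (Set.Iic t).ncard := fun _ _ h =>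
  Set.ncard_lt_ncard (Set.Iic_ssubset_Iic.2 h) (finite_Iic _)

instance : WellFoundedLT T := (ncard_Iic_strictMono T).wellFoundedLT

instance (t : T) : Finite {s : T // s < t} :=
  ((finite_Iic t).subset (fun _ h => le_of_lt h : {s | s < t} ⊆ _)).to_subtype

instance (t : T) : Finite {s : T // s < t}ᵒᵖ := Finite.of_equiv _ equivToOpposite

end CofinitePoset

/-! ### Lifting against special maps and for levelwise maps -/

namespace ProObj

variable {C : Type u} [Category.{v} C]

section

variable [HasFiniteLimits C]

/-- The coordinates of the lift are chosen by recursion on `t`. Specialness is exactly what turns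
the extension problem at `t` into one lifting problem against a map of `M`. -/
lemma hasLiftingProperty_ofNatTrans_of_isSpecial {M : MorphismProperty C} {A B : ProObj.{w} C}
    {i : A ⟶ B} (hi : (ofBase.{w} M).llp i) {T : Type w} [PartialOrder T] [CofinitePoset T]
    [Nonempty T] [IsDirectedOrder T] {X Y : Tᵒᵖ ⥤ C} {φ : X ⟶ Y} (hφ : IsSpecial M φ) :
    HasLiftingProperty i (ofNatTrans φ) := by
  rw [ofBase_llp_iff] at hi
  refine ⟨fun {u v} sq => ?_⟩
  have hw : ∀ t : Tᵒᵖ, ColimHom.postcomp (φ.app t) (Hom.coord u t) =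
      Hom.precomp i (Hom.coord v t) := fun t =>
    congrFun (congrArg Hom.coord sq.w) t
  obtain ⟨z, hz, hR⟩ := exists_compatible_family (α := T)
    (β := fun t => ColimHom B (X.obj (op t)))
    (fun t z => Hom.precomp i z = Hom.coord u (op t) ∧
      ColimHom.postcomp (φ.app (op t)) z = Hom.coord v (op t))
    (fun t s y z => ∀ h : s ≤ t, ColimHom.postcomp (X.map (homOfLE h).op) z = y) (by
      intro t x hx hR
      obtain ⟨P, p, q, h, hM⟩ := hφ t
      -- The coordinates already chosen below `t` glue to an element over `lim_{s < t} X_s`; with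
      -- the `t`-coordinate of `v` it then gives an element `y` over the fibre product.
      obtain ⟨y₀, hy₀⟩ := ColimHom.exists_postcomp_eq_of_isLimit (X := B)
        (limit.isLimit (belowIncl t ⋙ X)) (fun s => x s.unop.1 s.unop.2) (by
          intro s s' k
          obtain hlt | heq := lt_or_eq_of_le (show s'.unop.1 ≤ s.unop.1 from k.unop.le)
          · exact hR _ s.unop.2 _ hlt hlt.le
          · obtain rfl : s' = s := Opposite.unop_injective (Subtype.ext heq)
            obtain rfl : k = 𝟙 _ := Subsingleton.elim _ _
            simp)
      obtain ⟨y, hyp, hyq⟩ := ColimHom.exists_postcomp_eq_of_isPullback h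
        (Hom.coord v (op t)) y₀ (by
          refine ColimHom.ext_of_isLimit (limit.isLimit (belowIncl t ⋙ Y)) fun s => ?_
          rw [ColimHom.postcomp_postcomp, ColimHom.postcomp_postcomp]
          change ColimHom.postcomp (toBelow Y t ≫ limit.π _ s) _ =
            ColimHom.postcomp (belowMap φ t ≫ limit.π _ s) _
          rw [toBelow_π, belowMap, limMap_π, ← ColimHom.postcomp_postcomp]
          refine (Hom.compat v (s := op t) (s' := op s.unop.1) _).trans ?_
          refine (hx _ s.unop.2).2.symm.trans ?_
          exact congrArg _ (hy₀ s).symm)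
      have hlift := (hasLiftingProperty_simple_map_iff i _).1 (hi _ hM) (Hom.coord u (op t)) y (by
        apply ColimHom.ext_of_isPullback h
        · rw [ColimHom.postcomp_postcomp, h.lift_fst, Hom.postcomp_precomp, hyp, hw]
        · rw [ColimHom.postcomp_postcomp, h.lift_snd, Hom.postcomp_precomp, hyq]
          refine ColimHom.ext_of_isLimit (limit.isLimit (belowIncl t ⋙ X)) fun s => ?_
          rw [ColimHom.postcomp_postcomp, Hom.postcomp_precomp, hy₀]
          refine Eq.trans ?_ (hx _ s.unop.2).1.symm
          change ColimHom.postcomp (toBelow X t ≫ limit.π _ s) _ = _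
          rw [toBelow_π]
          exact Hom.compat u (s := op t) (s' := op s.unop.1) _)
      obtain ⟨z, hz₁, hz₂⟩ := hlift
      refine ⟨z, ⟨hz₁, ?_⟩, fun s hs h' => ?_⟩
      · rw [← hyp, ← hz₂, ColimHom.postcomp_postcomp, h.lift_fst]
      · have e : y₀ = ColimHom.postcomp (toBelow X t) z := by
          rw [← hyq, ← hz₂, ColimHom.postcomp_postcomp, h.lift_snd]
        refine Eq.trans ?_ (hy₀ (op ⟨s, hs⟩))
        rw [e, ColimHom.postcomp_postcomp]
        exact congrArg (fun f => ColimHom.postcomp f z) (toBelow_π X t (op ⟨s, hs⟩)).symm)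
  refine ⟨⟨⟨Hom.mk (fun t => z t.unop) ?_, ?_, ?_⟩⟩⟩
  · intro t t' k
    obtain hlt | heq := lt_or_eq_of_le k.unop.le
    · exact hR _ _ hlt hlt.le
    · obtain rfl : t' = t := Opposite.unop_injective heq
      obtain rfl : k = 𝟙 _ := Subsingleton.elim _ _
      exact (congrArg (fun f => ColimHom.postcomp f (z t'.unop)) (X.map_id t')).trans
        (ColimHom.postcomp_id _)
  · exact hom_ext fun t => (hz t.unop).1
  · exact hom_ext fun t => (hz t.unop).2

lemma ofBase_llp_le_Sp_llp (M : MorphismProperty C) : (ofBase.{w} M).llp ≤ (Sp.{w} M).llp := by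
  rintro A B i hi X Y f ⟨T, _, _, _, _, X', Y', φ, hφ, ⟨e⟩⟩
  have := hasLiftingProperty_ofNatTrans_of_isSpecial hi hφ
  exact HasLiftingProperty.of_arrow_iso_right i e.symm

end

/-- A square from a levelwise map to a map of simple objects is represented by a strictly
commutative square at a single index `s`, where `N ⊥ M` applies. -/
lemma Lw_le_ofBase_llp {N M : MorphismProperty C} (h : N ≤ M.llp) :
    Lw.{w} N ≤ (ofBase.{w} M).llp := by
  rintro A B i ⟨I, _, _, X, Y, φ, hφ, ⟨e⟩⟩
  rw [MorphismProperty.arrow_mk_iso_iff (ofBase.{w} M).llp e, ofBase_llp_iff]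
  intro c d m hm
  rw [hasLiftingProperty_simple_map_iff]
  intro x y hxy
  obtain ⟨t, u, rfl⟩ := x.exists_rep
  obtain ⟨t', v, rfl⟩ := y.exists_rep
  obtain ⟨s, k, k', hk⟩ := (ColimHom.mk_eq_mk_iff (X := of X) (c := d) (u ≫ m) (φ.app t' ≫ v)).1 hxy
  have := h _ (hφ s) m hm
  have sq : CommSq (X.map k ≫ u) (φ.app s) m (Y.map k' ≫ v) := ⟨by
    rw [Category.assoc, ← NatTrans.naturality_assoc]
    exact hk⟩
  refine ⟨ColimHom.mk (X := of Y) s sq.lift, ?_, ?_⟩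
  · change ColimHom.mk (X := of X) s (φ.app s ≫ sq.lift) = _
    rw [sq.fac_left]
    exact ColimHom.mk_restrict (X := of X) k u
  · rw [ColimHom.postcomp_mk, sq.fac_right]
    exact ColimHom.mk_restrict (X := of Y) k' v

/-! ### Simple maps as special maps -/

section Const

variable (I J : Type w) [SmallCategory.{w} I] [IsCofiltered I] [SmallCategory.{w} J]
  [IsCofiltered J]

/-- The canonical morphism between constant pro-objects with different index categories. -/
noncomputable def constHom (c : C) : of ((Functor.const I).obj c) ⟶ of ((Functor.const J).obj c) :=
  Hom.mk (fun _ => ColimHom.mk (X := of ((Functor.const I).obj c))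
    (IsCofiltered.nonempty (C := I)).some (𝟙 c)) (fun _ => ColimHom.postcomp_id _)

lemma mk_const_eq (c d : C) (i i' : I) (f : c ⟶ d) :
    ColimHom.mk (X := of ((Functor.const I).obj c)) i f = ColimHom.mk i' f := by
  rw [ColimHom.mk_eq_mk_iff]
  exact ⟨_, IsCofiltered.minToLeft i i', IsCofiltered.minToRight i i', rfl⟩

lemma constHom_comp_constHom (c : C) : constHom I J c ≫ constHom J I c = 𝟙 _ :=
  hom_ext fun i =>
    (congrArg (ColimHom.mk (X := of ((Functor.const I).obj c))
      (IsCofiltered.nonempty (C := I)).some) (Category.id_comp (𝟙 c))).trans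
      (mk_const_eq I c c _ i (𝟙 c))

/-- Constant pro-objects do not depend on the index category. -/
noncomputable def constIso (c : C) :
    of ((Functor.const I).obj c) ≅ of ((Functor.const J).obj c) where
  hom := constHom I J c
  inv := constHom J I c
  hom_inv_id := constHom_comp_constHom I J c
  inv_hom_id := constHom_comp_constHom J I c

/-- Constant morphisms of pro-objects do not depend on the index category. -/
noncomputable def constArrowIso {c d : C} (f : c ⟶ d) :
    Arrow.mk (ofNatTrans ((Functor.const I).map f)) ≅
      Arrow.mk (ofNatTrans ((Functor.const J).map f)) :=
  Arrow.isoMk (constIso I J c) (constIso I J d) (hom_ext fun _ => by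
    refine (congrArg (ColimHom.mk (X := of ((Functor.const I).obj c)) _) ?_)
    exact (Category.id_comp f).trans (Category.comp_id f).symm)

end Const

/-- With nothing below `t`, both limits are terminal, so the condition at `t` concerns only `φ_t`.
-/
lemma isSpecial_of_isEmpty_below [HasFiniteLimits C] {M : MorphismProperty C} {T : Type w}
    [PartialOrder T] [CofinitePoset T] [∀ t : T, IsEmpty {s : T // s < t}] {X Y : Tᵒᵖ ⥤ C}
    {φ : X ⟶ Y} (h : IsLevelwise M φ) : IsSpecial M φ := by
  intro t
  have hs : ∀ (F : Tᵒᵖ ⥤ C) {W : C} (f g : W ⟶ limit (belowIncl t ⋙ F)), f = g := fun F W f g =>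
    limit.hom_ext fun s => isEmptyElim s.unop
  have : IsIso (belowMap φ t) :=
    ⟨limit.lift (belowIncl t ⋙ X)
      { pt := _
        π := { app := fun s => isEmptyElim s.unop
               naturality := fun s => isEmptyElim s.unop } }, hs _ _ _, hs _ _ _⟩
  -- Taking `Y_t` itself as the fibre product makes the natural map equal to `φ_t`, so `M` need not
  -- be closed under isomorphism.
  have hp : IsPullback (𝟙 _) (toBelow Y t ≫ inv (belowMap φ t)) (toBelow Y t) (belowMap φ t) :=
    IsPullback.of_horiz_isIso ⟨by simp⟩
  refine ⟨_, _, _, hp, ?_⟩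
  have e := hp.lift_fst (φ.app (op t)) (toBelow X t) (toBelow_comp_belowMap φ t)
  rw [Category.comp_id] at e
  rw [e]
  exact h _

instance : CofinitePoset PUnit.{w + 1} := ⟨fun _ => Set.toFinite _⟩

instance (t : PUnit.{w + 1}) : IsEmpty {s : PUnit.{w + 1} // s < t} := ⟨fun s => lt_irrefl _ s.2⟩

lemma ofBase_le_Sp [HasFiniteLimits C] (M : MorphismProperty C) : ofBase.{w} M ≤ Sp.{w} M := by
  rintro A B i ⟨c, d, f, hf, ⟨e⟩⟩
  exact ⟨PUnit.{w + 1}, inferInstance, inferInstance, inferInstance, inferInstance, _, _,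
    (Functor.const PUnit.{w + 1}ᵒᵖ).map f, isSpecial_of_isEmpty_below (fun _ => hf),
    ⟨e.symm ≪≫ constArrowIso _ _ f⟩⟩

lemma Sp_llp_eq [HasFiniteLimits C] (M : MorphismProperty C) :
    (Sp.{w} M).llp = (ofBase.{w} M).llp :=
  le_antisymm (MorphismProperty.antitone_llp (ofBase_le_Sp M)) (ofBase_llp_le_Sp_llp M)

end ProObj

namespace CategoryTheory.MorphismProperty

/-- Right lifting classes are closed under retracts; the equality follows by the Galois connection
between `llp` and `rlp`. -/
lemma llp_retracts {C : Type*} [Category* C] (T : MorphismProperty C) :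
    T.retracts.llp = T.llp :=
  le_antisymm (antitone_llp T.le_retracts) (by
    rw [le_llp_iff_le_rlp, retracts_le_iff, ← le_llp_iff_le_rlp])

end CategoryTheory.MorphismProperty

/-- The value at `b` must exceed `c b` and the finitely many values below `b`. Directedness bounds
these, and infinite height makes the inequality strict. -/
lemma CofinitePoset.exists_strictMono_ge {A B : Type w} [PartialOrder A] [IsDirectedOrder A]
    [NoMaxOrder A] [PartialOrder B] [CofinitePoset B] (c : B → A) :
    ∃ α : B → A, StrictMono α ∧ ∀ b, c b ≤ α b := by
  obtain ⟨α, h₁, h₂⟩ := exists_compatible_family (α := B) (β := fun _ => A)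
    (fun b a => c b ≤ a) (fun _ _ a' a => a' < a) (by
      intro b x _ _
      have : Nonempty A := ⟨c b⟩
      obtain ⟨a, ha⟩ := (Set.finite_range fun b' : {b' : B // b' < b} => x b'.1 b'.2).bddAbove
      obtain ⟨a', h, h'⟩ := exists_ge_ge a (c b)
      obtain ⟨a'', ha''⟩ := exists_gt a'
      exact ⟨a'', h'.trans ha''.le, fun b' hb' =>
        ((ha ⟨⟨b', hb'⟩, rfl⟩).trans h).trans_lt ha''⟩)
  exact ⟨α, fun _ _ h => h₂ _ _ h, h₁⟩

namespace CategoryTheory.Functor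

variable {C : Type u} [Category.{v} C] {T : Type w} [Preorder T] (F : Tᵒᵖ ⥤ C)

lemma map_homOfLE_comp_map {a b c : T} (h : a ≤ b) (h' : b ≤ c) :
    F.map (homOfLE h').op ≫ F.map (homOfLE h).op = F.map (homOfLE (h.trans h')).op :=
  (F.map_comp _ _).symm

lemma map_homOfLE_comp_map_assoc {a b c : T} (h : a ≤ b) (h' : b ≤ c) {Z : C}
    (f : F.obj (op a) ⟶ Z) :
    F.map (homOfLE h').op ≫ F.map (homOfLE h).op ≫ f = F.map (homOfLE (h.trans h')).op ≫ f := by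
  rw [← Category.assoc, map_homOfLE_comp_map]

end CategoryTheory.Functor

/-! ### Reindexing along cofinal monotone maps -/

namespace ProObj

variable {C : Type u} [Category.{v} C]

section Reindex

variable {I D : Type w} [PartialOrder I] [PartialOrder D] [Nonempty D]
  [IsDirectedOrder D] {p : D → I} (hp : Monotone p)

/-- This makes the arbitrary choices in the inverse of `reindexIso` harmless. -/
lemma mk_reindex_eq (F : Iᵒᵖ ⥤ C) {i : I} {d d' : D} (h : i ≤ p d) (h' : i ≤ p d') :
    ColimHom.mk (X := of (hp.functor.op ⋙ F)) (op d) (F.map (homOfLE h).op) =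
      ColimHom.mk (X := of (hp.functor.op ⋙ F)) (op d') (F.map (homOfLE h').op) := by
  obtain ⟨e, he, he'⟩ := exists_ge_ge d d'
  rw [ColimHom.mk_eq_mk_iff]
  exact ⟨op e, (homOfLE he).op, (homOfLE he').op,
    (F.map_comp (homOfLE (hp he)).op (homOfLE h).op).symm.trans
      (F.map_comp (homOfLE (hp he')).op (homOfLE h').op)⟩

variable [Nonempty I] [IsDirectedOrder I]

/-- The canonical morphism from a diagram to its reindexing. -/
def reindexHom (F : Iᵒᵖ ⥤ C) : of F ⟶ of (hp.functor.op ⋙ F) :=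
  homOfFunctor (X := of F) (Y := of (hp.functor.op ⋙ F)) hp.functor.op (𝟙 _)

/-- Reindexing along a cofinal map is an isomorphism. -/
noncomputable def reindexIso (hc : ∀ i, ∃ d, i ≤ p d) (F : Iᵒᵖ ⥤ C) :
    of F ≅ of (hp.functor.op ⋙ F) where
  hom := reindexHom hp F
  inv := Hom.mk (fun i => ColimHom.mk (X := of (hp.functor.op ⋙ F)) (op (hc i.unop).choose)
      (F.map (homOfLE (hc i.unop).choose_spec).op)) (fun {i i'} k => by
    rw [ColimHom.postcomp_mk]
    refine Eq.trans ?_ (mk_reindex_eq hp F (k.unop.le.trans (hc i.unop).choose_spec) _)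
    exact congrArg (ColimHom.mk (X := of (hp.functor.op ⋙ F)) _) (F.map_comp _ k).symm)
  hom_inv_id := hom_ext fun i => by
    change ColimHom.mk (X := of F) _ (𝟙 _ ≫ F.map _) = ColimHom.mk i (𝟙 _)
    rw [Category.id_comp]
    exact (congrArg (ColimHom.mk _) (Category.comp_id _).symm).trans
      (ColimHom.mk_restrict (X := of F) (homOfLE (hc i.unop).choose_spec).op (𝟙 (F.obj i)))
  inv_hom_id := hom_ext fun d => by
    change ColimHom.mk (X := of (hp.functor.op ⋙ F)) _ (F.map _ ≫ 𝟙 _) = ColimHom.mk d (𝟙 _)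
    rw [Category.comp_id]
    refine (mk_reindex_eq hp F _ le_rfl).trans ?_
    exact congrArg (ColimHom.mk (X := of (hp.functor.op ⋙ F)) d) (F.map_id (op (p d.unop)))

lemma reindexHom_naturality {F G : Iᵒᵖ ⥤ C} (φ : F ⟶ G) :
    reindexHom hp F ≫ ofNatTrans (Functor.whiskerLeft hp.functor.op φ) =
      ofNatTrans φ ≫ reindexHom hp G :=
  hom_ext fun d => congrArg (ColimHom.mk (X := of F) (op (p d.unop)))
    ((Category.id_comp (φ.app (op (p d.unop)))).trans (Category.comp_id _).symm)

/-- Reindexing along a cofinal map does not change the isomorphism class of a levelwise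
morphism. -/
noncomputable def reindexArrowIso (hc : ∀ i, ∃ d, i ≤ p d) {F G : Iᵒᵖ ⥤ C} (φ : F ⟶ G) :
    Arrow.mk (ofNatTrans φ) ≅ Arrow.mk (ofNatTrans (Functor.whiskerLeft hp.functor.op φ)) :=
  Arrow.isoMk (reindexIso hp hc F) (reindexIso hp hc G) (reindexHom_naturality hp φ)

end Reindex

end ProObj

/-! ### The cofinite model is fully faithful in the pro-category -/

namespace BarPro

variable {C : Type u} [Category.{v} C]

/-- A 1-morphism from its components. -/
def OneHom.ofApp {F G : BarPro.{w} C} {α : G.Index → F.Index} (hα : StrictMono α)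
    (app : ∀ b, F.diag.obj (op (α b)) ⟶ G.diag.obj (op b))
    (h : ∀ (b b' : G.Index) (k : b ≤ b'), F.diag.map (homOfLE (hα.monotone k)).op ≫ app b =
      app b' ≫ G.diag.map (homOfLE k).op) : OneHom F G where
  fn := α
  strictMono := hα
  nat :=
    { app := fun b => app b.unop
      naturality := fun _ _ k => h _ _ k.unop.le }

/-- The restriction of a 1-morphism along a larger function on indices. -/
def OneHom.restrict {F G : BarPro.{w} C} (f : OneHom F G) {γ : G.Index → F.Index}
    (hγ : StrictMono γ) (h : ∀ b, f.fn b ≤ γ b) : OneHom F G :=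
  .ofApp hγ (fun b => F.diag.map (homOfLE (h b)).op ≫ f.app b) (fun b b' k => by
    rw [Category.assoc, ← f.app_naturality k, Functor.map_homOfLE_comp_map_assoc,
      Functor.map_homOfLE_comp_map_assoc])

lemma OneHom.le_restrict {F G : BarPro.{w} C} (f : OneHom F G) {γ : G.Index → F.Index}
    (hγ : StrictMono γ) (h : ∀ b, f.fn b ≤ γ b) : f ≤ f.restrict hγ h :=
  ⟨h, fun _ => rfl⟩

/-- If two 1-morphisms agree in `Pro(C)`, their components at `b` agree after restriction to some `s
b`. A strictly increasing `γ ≥ s` yields a single 1-morphism above both. -/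
instance : (toPro.{w} C).Faithful where
  map_injective {F G} := by
    rintro ⟨f⟩ ⟨g⟩ h
    have h' : ∀ b : G.Index, ∃ (s : F.Index) (k : f.fn b ≤ s) (k' : g.fn b ≤ s),
        F.diag.map (homOfLE k).op ≫ f.app b = F.diag.map (homOfLE k').op ≫ g.app b := by
      intro b
      obtain ⟨s, k, k', e⟩ := (ProObj.ColimHom.mk_eq_mk_iff (X := ProObj.of F.diag)
        (f.app b) (g.app b)).1 (congrFun (congrArg ProObj.Hom.coord h) (op b))
      exact ⟨s.unop, k.unop.le, k'.unop.le, e⟩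
    choose s k k' e using h'
    obtain ⟨γ, hγ, hs⟩ := CofinitePoset.exists_strictMono_ge s
    have hf : f ≤ f.restrict hγ fun b => (k b).trans (hs b) := f.le_restrict _ _
    have hg : g ≤ f.restrict hγ fun b => (k b).trans (hs b) := ⟨fun b => (k' b).trans (hs b),
      fun b => by
        change _ = F.diag.map _ ≫ f.app b
        have := congrArg (F.diag.map (homOfLE (hs b)).op ≫ ·) (e b)
        rw [Functor.map_homOfLE_comp_map_assoc, Functor.map_homOfLE_comp_map_assoc] at this
        exact this.symm⟩
    exact (Quot.sound hf).trans (Quot.sound hg).symm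

/-- Representatives of the coordinates are natural only after restriction. For fixed `b` there are
finitely many `b' ≤ b` to deal with, so one index `c b` suffices, and a strictly increasing `α ≥ c`
makes the restricted representatives a 1-morphism. -/
instance : (toPro.{w} C).Full where
  map_surjective {F G} := by
    intro f
    have h₀ : ∀ b : G.Index, ∃ (a : F.Index) (f₀ : F.diag.obj (op a) ⟶ G.diag.obj (op b)),
        ProObj.ColimHom.mk (X := ProObj.of F.diag) (op a) f₀ = ProObj.Hom.coord f (op b) := by
      intro b
      obtain ⟨a, f₀, h⟩ := (ProObj.Hom.coord f (op b)).exists_rep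
      exact ⟨a.unop, f₀, h⟩
    choose a₀ f₀ hf₀ using h₀
    have hs : ∀ (b : G.Index) (b' : Set.Iic b), ∃ (s : F.Index) (k : a₀ b ≤ s) (k' : a₀ b'.1 ≤ s),
        F.diag.map (homOfLE k).op ≫ f₀ b ≫ G.diag.map (homOfLE b'.2).op =
          F.diag.map (homOfLE k').op ≫ f₀ b'.1 := by
      intro b b'
      obtain ⟨s, k, k', e⟩ := (ProObj.ColimHom.mk_eq_mk_iff (X := ProObj.of F.diag)
        (f₀ b ≫ G.diag.map (homOfLE b'.2).op) (f₀ b'.1)).1 (by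
          refine Eq.trans ?_ (hf₀ b'.1).symm
          refine Eq.trans ?_ (ProObj.Hom.compat f (s := op b) (s' := op b'.1) (homOfLE b'.2).op)
          exact congrArg (ProObj.ColimHom.postcomp (G.diag.map (homOfLE b'.2).op)) (hf₀ b))
      exact ⟨s.unop, k.unop.le, k'.unop.le, e⟩
    choose s k k' e using hs
    have hc : ∀ b : G.Index, ∃ c : F.Index, ∀ b', s b b' ≤ c := by
      intro b
      have := (CofinitePoset.finite_Iic b).to_subtype
      obtain ⟨c, hc⟩ := (Set.finite_range (s b)).bddAbove
      exact ⟨c, fun b' => hc ⟨b', rfl⟩⟩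
    choose c hc using hc
    obtain ⟨α, hα, h⟩ := CofinitePoset.exists_strictMono_ge c
    have hle : ∀ b, a₀ b ≤ α b := fun b => (k b ⟨b, le_rfl⟩).trans ((hc b _).trans (h b))
    let g : OneHom F G := .ofApp hα (fun b => F.diag.map (homOfLE (hle b)).op ≫ f₀ b) (by
      intro b' b hb
      have h₁ := congrArg (F.diag.map (homOfLE ((hc b ⟨b', hb⟩).trans (h b))).op ≫ ·) (e b ⟨b', hb⟩)
      dsimp only at h₁
      rw [Functor.map_homOfLE_comp_map_assoc, Functor.map_homOfLE_comp_map_assoc] at h₁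
      rw [Functor.map_homOfLE_comp_map_assoc, Category.assoc]
      exact h₁.symm)
    refine ⟨Hom.mk g, ProObj.hom_ext fun b => ?_⟩
    exact (ProObj.ColimHom.mk_restrict (X := ProObj.of F.diag) (homOfLE (hle b.unop)).op
      (f₀ b.unop)).trans (hf₀ b.unop)

/-- Isomorphisms of arrows lift along the fully faithful functor to the pro-category. -/
noncomputable def arrowIsoOfToPro {X Y X' Y' : BarPro.{w} C} {f : X ⟶ Y} {g : X' ⟶ Y'}
    (e : Arrow.mk ((toPro C).map f) ≅ Arrow.mk ((toPro C).map g)) : Arrow.mk f ≅ Arrow.mk g :=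
  let l : (toPro C).obj X ≅ (toPro C).obj X' := Arrow.leftFunc.mapIso e
  let r : (toPro C).obj Y ≅ (toPro C).obj Y' := Arrow.rightFunc.mapIso e
  have w : l.hom ≫ (toPro C).map g = (toPro C).map f ≫ r.hom := e.hom.w
  Arrow.isoMk ((toPro C).preimageIso l) ((toPro C).preimageIso r)
    ((toPro C).map_injective (by simpa using w))

/-! ### Straightening a morphism to a natural transformation -/

section Level

variable {A B : Type w} [PartialOrder A] (α : B → A)

/-- The pairs `(a, b)` with `α b ≤ a`. -/
abbrev Above : Type w := {p : A × B // α p.2 ≤ p.1}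

lemma Above.exists_le_fst [IsDirectedOrder A] [Nonempty B] (a : A) :
    ∃ p : Above α, a ≤ p.1.1 := by
  obtain ⟨c, hc, hc'⟩ := exists_ge_ge a (α (Classical.arbitrary B))
  exact ⟨⟨(c, _), hc'⟩, hc⟩

variable [PartialOrder B]

lemma Above.monotone_fst : Monotone fun p : Above α => p.1.1 := fun _ _ h => h.1

lemma Above.monotone_snd : Monotone fun p : Above α => p.1.2 := fun _ _ h => h.2

instance [CofinitePoset A] [CofinitePoset B] : CofinitePoset (Above α) where
  finite_Iic p := by
    refine Set.Finite.of_finite_image (f := Subtype.val) ?_ Subtype.val_injective.injOn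
    refine (((CofinitePoset.finite_Iic p.1.1).prod (CofinitePoset.finite_Iic p.1.2))).subset ?_
    rintro _ ⟨q, hq, rfl⟩
    exact hq

instance [Nonempty B] : Nonempty (Above α) :=
  ⟨⟨(α (Classical.arbitrary B), Classical.arbitrary B), le_rfl⟩⟩

instance [IsDirectedOrder A] [IsDirectedOrder B] : IsDirectedOrder (Above α) where
  directed p q := by
    obtain ⟨b, hb, hb'⟩ := exists_ge_ge p.1.2 q.1.2
    obtain ⟨a, ha, ha'⟩ := exists_ge_ge p.1.1 q.1.1
    obtain ⟨c, hc, hc'⟩ := exists_ge_ge a (α b)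
    exact ⟨⟨(c, b), hc'⟩, ⟨ha.trans hc, hb⟩, ⟨ha'.trans hc, hb'⟩⟩

instance [NoMaxOrder A] : NoMaxOrder (Above α) where
  exists_gt p := by
    obtain ⟨a, ha⟩ := exists_gt p.1.1
    exact ⟨⟨(a, p.1.2), p.2.trans ha.le⟩, Prod.mk_lt_mk_iff_left.2 ha⟩

lemma Above.exists_le_snd (b : B) : ∃ p : Above α, b ≤ p.1.2 := ⟨⟨(α b, b), le_rfl⟩, le_rfl⟩

end Level

/-- Every morphism is isomorphic to one that comes from a natural transformation. -/
lemma exists_arrow_iso_ofNatTrans {F G : BarPro.{w} C} (f : F ⟶ G) :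
    ∃ (A : Type w) (_ : PartialOrder A) (_ : CofinitePoset A) (_ : Nonempty A)
      (_ : IsDirectedOrder A) (_ : NoMaxOrder A) (X Y : Aᵒᵖ ⥤ C) (φ : X ⟶ Y),
      Nonempty (Arrow.mk f ≅ Arrow.mk (ofNatTrans φ)) := by
  obtain ⟨f⟩ := f
  let φ : (Above.monotone_fst f.fn).functor.op ⋙ F.diag ⟶
      (Above.monotone_snd f.fn).functor.op ⋙ G.diag :=
    { app := fun p => F.diag.map (homOfLE p.unop.2).op ≫ f.app p.unop.1.2
      naturality := fun p q k => by
        have h₁ : q.unop.1.1 ≤ p.unop.1.1 := k.unop.le.1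
        have h₂ : q.unop.1.2 ≤ p.unop.1.2 := k.unop.le.2
        change F.diag.map (homOfLE h₁).op ≫ F.diag.map (homOfLE q.unop.2).op ≫ f.app q.unop.1.2 =
          (F.diag.map (homOfLE p.unop.2).op ≫ f.app p.unop.1.2) ≫ G.diag.map (homOfLE h₂).op
        rw [Category.assoc, ← f.app_naturality h₂, Functor.map_homOfLE_comp_map_assoc,
          Functor.map_homOfLE_comp_map_assoc] }
  refine ⟨Above f.fn, inferInstance, inferInstance, inferInstance, inferInstance, inferInstance,
    _, _, φ, ⟨arrowIsoOfToPro ?_⟩⟩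
  -- Both projections from the poset of pairs are monotone and cofinal, so source and target are
  -- only reindexed.
  refine Arrow.isoMk
    (ProObj.reindexIso (Above.monotone_fst f.fn) (Above.exists_le_fst f.fn) F.diag)
    (ProObj.reindexIso (Above.monotone_snd f.fn) (Above.exists_le_snd f.fn) G.diag)
    (ProObj.hom_ext fun p => ?_)
  change ProObj.ColimHom.mk (X := ProObj.of F.diag) (op p.unop.1.1)
    (𝟙 _ ≫ F.diag.map (homOfLE p.unop.2).op ≫ f.app p.unop.1.2) =
    ProObj.ColimHom.mk (X := ProObj.of F.diag) (op (f.fn p.unop.1.2)) (f.app p.unop.1.2 ≫ 𝟙 _)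
  rw [Category.id_comp, Category.comp_id]
  exact ProObj.ColimHom.mk_restrict (X := ProObj.of F.diag) _ _

/-! ### Transfer of lifting properties -/

section Llp

lemma hasLiftingProperty_of_toPro {A B X Y : BarPro.{w} C} {i : A ⟶ B} {p : X ⟶ Y}
    (h : HasLiftingProperty ((toPro C).map i) ((toPro C).map p)) : HasLiftingProperty i p where
  sq_hasLift {f g} sq := by
    have sq' := sq.map (toPro C)
    exact ⟨⟨(toPro C).preimage sq'.lift, (toPro C).map_injective (by simp),
      (toPro C).map_injective (by simp)⟩⟩

lemma toPro_hasLiftingProperty {A B X Y : BarPro.{w} C} {i : A ⟶ B} {p : X ⟶ Y}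
    (h : HasLiftingProperty i p) : HasLiftingProperty ((toPro C).map i) ((toPro C).map p) where
  sq_hasLift {f g} sq := by
    have sq' : CommSq ((toPro C).preimage f) i p ((toPro C).preimage g) :=
      ⟨(toPro C).map_injective (by simpa using sq.w)⟩
    refine ⟨⟨(toPro C).map sq'.lift, ?_, ?_⟩⟩
    · rw [← Functor.map_comp, sq'.fac_left, Functor.map_preimage]
    · rw [← Functor.map_comp, sq'.fac_right, Functor.map_preimage]

instance : CofinitePoset (ULift.{w} ℕ) where
  finite_Iic n := by
    refine Set.Finite.of_finite_image (f := ULift.down) ((Set.finite_Iic n.down).subset ?_)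
      ULift.down_injective.injOn
    rintro _ ⟨m, hm, rfl⟩
    exact hm

instance : NoMaxOrder (ULift.{w} ℕ) where
  exists_gt n := ⟨⟨n.down + 1⟩, Nat.lt_succ_self n.down⟩

/-- The one-point poset has no infinite height, so simple objects are replaced by constant diagrams
on the natural numbers, to which they are isomorphic in `Pro(C)`. -/
lemma toPro_map_ofBase_llp {M : MorphismProperty C} {A B : BarPro.{w} C} {f : A ⟶ B}
    (hf : (ofBase.{w} M).llp f) : (ProObj.ofBase.{w} M).llp ((toPro C).map f) := by
  rw [ProObj.ofBase_llp_iff]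
  intro c d m hm
  let e := ProObj.constArrowIso (Discrete PUnit.{w + 1}) (ULift.{w} ℕ)ᵒᵖ m
  have : HasLiftingProperty ((toPro C).map f)
      (ProObj.ofNatTrans ((Functor.const (ULift.{w} ℕ)ᵒᵖ).map m)) := toPro_hasLiftingProperty (hf
    (ofNatTrans ((Functor.const (ULift.{w} ℕ)ᵒᵖ).map m)) ⟨c, d, m, hm, ⟨e⟩⟩)
  exact HasLiftingProperty.of_arrow_iso_right ((toPro C).map f) e.symm

lemma ofBase_llp_iff {M : MorphismProperty C} {A B : BarPro.{w} C} {f : A ⟶ B} :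
    (ofBase.{w} M).llp f ↔ (ProObj.ofBase.{w} M).llp ((toPro C).map f) :=
  ⟨toPro_map_ofBase_llp, fun h _ _ _ hp => hasLiftingProperty_of_toPro (h _ hp)⟩

lemma Sp_llp_eq [HasFiniteLimits C] (M : MorphismProperty C) :
    (Sp.{w} M).llp = (ofBase.{w} M).llp := by
  refine le_antisymm (MorphismProperty.antitone_llp fun _ _ f hf => ProObj.ofBase_le_Sp M _ hf) ?_
  intro A B f hf X Y _ hp
  exact hasLiftingProperty_of_toPro
    (ProObj.ofBase_llp_le_Sp_llp M _ (toPro_map_ofBase_llp hf) _ hp)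

lemma Lw_le_ofBase_llp {N M : MorphismProperty C} (h : N ≤ M.llp) :
    Lw.{w} N ≤ (ofBase.{w} M).llp := fun _ _ _ hf =>
  ofBase_llp_iff.2 (ProObj.Lw_le_ofBase_llp h _ hf)

end Llp

end BarPro

/-! ### Building diagrams on posets -/

section OfLT

variable {C : Type*} [Category* C] {T : Type*} [PartialOrder T] {Q : T → C}
  (m : ∀ {t s : T}, s < t → (Q t ⟶ Q s))

open Classical in
/-- A diagram on a poset from its objects and its transition maps between distinct objects. -/
noncomputable def functorOfLT
    (hm : ∀ {t s l : T} (h : s < t) (h' : l < s), m h ≫ m h' = m (h'.trans h)) : Tᵒᵖ ⥤ C where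
  obj t := Q t.unop
  map {t s} k :=
    if e : s.unop = t.unop then eqToHom (by rw [e]) else m (lt_of_le_of_ne k.unop.le e)
  map_id t := dif_pos rfl
  map_comp {t s l} k k' := by
    obtain ⟨t⟩ := t
    obtain ⟨s⟩ := s
    obtain ⟨l⟩ := l
    have h₁ : s ≤ t := k.unop.le
    have h₂ : l ≤ s := k'.unop.le
    obtain rfl | h₁ := h₁.eq_or_lt
    · simp
    obtain rfl | h₂ := h₂.eq_or_lt
    · simp
    simp only [dif_neg h₁.ne, dif_neg h₂.ne, dif_neg (h₂.trans h₁).ne, hm]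

lemma functorOfLT_map
    (hm : ∀ {t s l : T} (h : s < t) (h' : l < s), m h ≫ m h' = m (h'.trans h))
    {t s : T} (h : s < t) : (functorOfLT m hm).map (homOfLE h.le).op = m h :=
  dif_neg h.ne

/-- A natural transformation between diagrams on a poset, from its naturality on transition maps
between distinct objects. -/
def natTransOfLT {F G : Tᵒᵖ ⥤ C} (app : ∀ t : T, F.obj (op t) ⟶ G.obj (op t))
    (h : ∀ {t s : T} (h : s < t), F.map (homOfLE h.le).op ≫ app s =
      app t ≫ G.map (homOfLE h.le).op) : F ⟶ G where
  app t := app t.unop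
  naturality t s k := by
    obtain heq | hlt := k.unop.le.eq_or_lt
    · obtain rfl : s = t := Opposite.unop_injective heq
      obtain rfl : k = 𝟙 _ := Subsingleton.elim _ _
      simp
    · exact h hlt

end OfLT

/-- A levelwise map for the closure of `N` under isomorphisms is isomorphic to a levelwise
`N`-map. -/
lemma exists_isLevelwise_of_isoClosure {C : Type*} [Category* C] {I : Type*} [Category* I]
    {N : MorphismProperty C} {X Y : I ⥤ C} {φ : X ⟶ Y}    (h : ∀ t, N.isoClosure (φ.app t)) :
    ∃ (X' Y' : I ⥤ C) (a : X ≅ X') (b : Y ≅ Y'), ∀ t, N ((a.inv ≫ φ ≫ b.hom).app t) := by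
  choose A B f hf e using h
  let a t : X.obj t ≅ A t := (Arrow.leftFunc.mapIso (e t).some).symm
  let b t : Y.obj t ≅ B t := (Arrow.rightFunc.mapIso (e t).some).symm
  refine ⟨_, _, X.isoCopyObj A a, Y.isoCopyObj B b, fun t => ?_⟩
  have : (((X.isoCopyObj A a).inv ≫ φ ≫ (Y.isoCopyObj B b).hom).app t) = f t := by
    have h₁ : (a t).inv ≫ φ.app t = f t ≫ (b t).inv := (e t).some.hom.w
    have h₂ : (a t).inv ≫ φ.app t ≫ (b t).hom = f t := by
      rw [← Category.assoc, h₁, Category.assoc, Iso.inv_hom_id, Category.comp_id]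
    exact h₂
  rw [this]
  exact hf t

/-! ### Levelwise-special factorization of natural transformations -/

section Special

variable {C : Type u} [Category.{v} C] [HasFiniteLimits C] {T : Type w} [PartialOrder T]
  [CofinitePoset T]

/-- The projection `lim_{s < t} X_s ⟶ X_s`. -/
noncomputable def belowπ (X : Tᵒᵖ ⥤ C) {s t : T} (h : s < t) :
    limit (belowIncl t ⋙ X) ⟶ X.obj (op s) :=
  limit.π (belowIncl t ⋙ X) (op ⟨s, h⟩)

lemma below_hom_ext {X : Tᵒᵖ ⥤ C} {t : T} {Z : C} {f g : Z ⟶ limit (belowIncl t ⋙ X)}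
    (h : ∀ (s : T) (hs : s < t), f ≫ belowπ X hs = g ≫ belowπ X hs) : f = g :=
  limit.hom_ext fun s => h s.unop.1 s.unop.2

@[simp] lemma toBelow_belowπ (X : Tᵒᵖ ⥤ C) {s t : T} (h : s < t) :
    toBelow X t ≫ belowπ X h = X.map (homOfLE h.le).op :=
  toBelow_π X t _

@[simp] lemma belowMap_belowπ {X Y : Tᵒᵖ ⥤ C} (φ : X ⟶ Y) {s t : T} (h : s < t) :
    belowMap φ t ≫ belowπ Y h = belowπ X h ≫ φ.app (op s) :=
  limMap_π _ _

lemma belowπ_comp_map (X : Tᵒᵖ ⥤ C) {r s t : T} (h : s < t) (h' : r ≤ s) :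
    belowπ X h ≫ X.map (homOfLE h').op = belowπ X (h'.trans_lt h) :=
  limit.w (belowIncl t ⋙ X) (j := op ⟨s, h⟩) (j' := op ⟨r, h'.trans_lt h⟩)
    (homOfLE (show (⟨r, h'.trans_lt h⟩ : {s // s < t}) ≤ ⟨s, h⟩ from h')).op

lemma belowMap_comp {X Y Z : Tᵒᵖ ⥤ C} (φ : X ⟶ Y) (ψ : Y ⟶ Z) (t : T) :
    belowMap (φ ≫ ψ) t = belowMap φ t ≫ belowMap ψ t :=
  below_hom_ext fun s hs => by
    rw [belowMap_belowπ, Category.assoc, belowMap_belowπ, ← Category.assoc, belowMap_belowπ,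
      Category.assoc, NatTrans.comp_app]

lemma isIso_belowMap {X Y : Tᵒᵖ ⥤ C} (φ : X ⟶ Y) (t : T)
    (h : ∀ s : T, s < t → IsIso (φ.app (op s))) : IsIso (belowMap φ t) := by
  have : ∀ s, IsIso ((Functor.whiskerLeft (belowIncl t) φ).app s) := fun s => h _ s.unop.2
  have : IsIso (Functor.whiskerLeft (belowIncl t) φ) := NatIso.isIso_of_isIso_app _
  exact inferInstanceAs (IsIso (limMap _))

/-- The condition of special `M`-maps at `t`. -/
def IsSpecialAt (M : MorphismProperty C) {X Y : Tᵒᵖ ⥤ C} (φ : X ⟶ Y) (t : T) : Prop :=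
  ∃ (P : C) (p : P ⟶ Y.obj (op t)) (q : P ⟶ limit (belowIncl t ⋙ X))
    (h : IsPullback p q (toBelow Y t) (belowMap φ t)),
    M (h.lift (φ.app (op t)) (toBelow X t) (toBelow_comp_belowMap φ t))

/-- Specialness at `t` sees the source below `t` only through `lim_{s < t}`, so a fibre product
formed with `W` serves for `Z`. The isomorphism `e` allows a change of fibre product when `M` is not
closed under isomorphism. -/
lemma isSpecialAt_of_isPullback {M : MorphismProperty C} {W Z Y : Tᵒᵖ ⥤ C} (θ : W ⟶ Z)
    {π : Z ⟶ Y} {t : T} (hθ : ∀ s : T, s < t → IsIso (θ.app (op s))) {P P' : C}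
    {p : P ⟶ Y.obj (op t)} {q : P ⟶ limit (belowIncl t ⋙ W)}
    (h : IsPullback p q (toBelow Y t) (belowMap (θ ≫ π) t)) (e : P ≅ P')
    (g : Z.obj (op t) ⟶ P') (hg : M g) (hp : g ≫ e.inv ≫ p = π.app (op t))
    (hq : g ≫ e.inv ≫ q ≫ belowMap θ t = toBelow Z t) : IsSpecialAt M π t := by
  have := isIso_belowMap θ t hθ
  have h' : IsPullback (e.inv ≫ p) (e.inv ≫ q ≫ belowMap θ t) (toBelow Y t) (belowMap π t) :=
    h.of_iso e (Iso.refl _) (asIso (belowMap θ t)) (Iso.refl _) (by simp) (by simp) (by simp)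
      (by simp [belowMap_comp])
  refine ⟨_, _, _, h', ?_⟩
  have : h'.lift (π.app (op t)) (toBelow Z t) (toBelow_comp_belowMap π t) = g :=
    h'.hom_ext (by rw [h'.lift_fst, hp]) (by rw [h'.lift_snd, hq])
  rwa [this]

lemma IsSpecialAt.of_isIso {M : MorphismProperty C} [M.RespectsIso] {W Z Y : Tᵒᵖ ⥤ C} (θ : W ⟶ Z)
    {π : Z ⟶ Y} {t : T} (hθ : ∀ s : T, s ≤ t → IsIso (θ.app (op s)))
    (h : IsSpecialAt M (θ ≫ π) t) : IsSpecialAt M π t := by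
  obtain ⟨P, p, q, h, hM⟩ := h
  have := hθ t le_rfl
  refine isSpecialAt_of_isPullback θ (fun s hs => hθ s hs.le) h (Iso.refl _)
    (inv (θ.app (op t)) ≫ h.lift _ _ (toBelow_comp_belowMap (θ ≫ π) t))
    ((M.cancel_left_of_respectsIso _ _).2 hM) ?_ ?_
  · simp
  · rw [Iso.refl_inv, Category.id_comp, Category.assoc, ← Category.assoc (h.lift _ _ _),
      h.lift_snd, ← toBelow_comp_belowMap θ t, IsIso.inv_hom_id_assoc]

section Glue

variable (W : Tᵒᵖ ⥤ C) {Q : T → C} (q : ∀ t, W.obj (op t) ⟶ Q t)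
  (r : ∀ t, Q t ⟶ limit (belowIncl t ⋙ W)) (hr : ∀ t, q t ≫ r t = toBelow W t)

-- The middle stretch `W_s ⟶ Q_s ⟶ lim_{l < s} W_l` is the natural map by `hr`, so the composite
-- collapses to a transition map of `W`.
include hr in
lemma glue_comp {t s l : T} (h : s < t) (h' : l < s) :
    (r t ≫ belowπ W h ≫ q s) ≫ r s ≫ belowπ W h' ≫ q l =
      r t ≫ belowπ W (h'.trans h) ≫ q l := by
  rw [Category.assoc, Category.assoc, ← Category.assoc (q s), hr, ← Category.assoc (toBelow W s),
    toBelow_belowπ, ← Category.assoc (belowπ W h), belowπ_comp_map]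

/-- The diagram obtained from `W` by replacing each `W_t` by an object `Q_t` through which the
natural map `W_t ⟶ lim_{s < t} W_s` factors. -/
noncomputable def glue : Tᵒᵖ ⥤ C :=
  functorOfLT (fun {t s} h => r t ≫ belowπ W h ≫ q s) (glue_comp W q r hr)

lemma glue_map {t s : T} (h : s < t) :
    (glue W q r hr).map (homOfLE h.le).op = r t ≫ belowπ W h ≫ q s :=
  functorOfLT_map _ (glue_comp W q r hr) h

/-- The natural transformation from a diagram to its modification. -/
noncomputable def toGlue : W ⟶ glue W q r hr :=
  natTransOfLT (G := glue W q r hr) q (fun {t s} h => by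
    have e : W.map (homOfLE h.le).op ≫ q s = q t ≫ r t ≫ belowπ W h ≫ q s := by
      rw [← Category.assoc, hr, ← Category.assoc, toBelow_belowπ]
    exact e.trans (congrArg (q t ≫ ·) (glue_map W q r hr h).symm))

variable {Y : Tᵒᵖ ⥤ C} (π : W ⟶ Y) (p : ∀ t, Q t ⟶ Y.obj (op t))
  (hp : ∀ t, q t ≫ p t = π.app (op t)) (h : ∀ t, p t ≫ toBelow Y t = r t ≫ belowMap π t)

/-- The natural transformation from a modified diagram. -/
noncomputable def glueDesc : glue W q r hr ⟶ Y :=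
  natTransOfLT (F := glue W q r hr) p (fun {t s} hlt => by
    rw [glue_map _ _ _ _ hlt]
    have := congrArg (· ≫ belowπ Y hlt) (h t)
    simp only [Category.assoc, toBelow_belowπ, belowMap_belowπ, ← hp] at this
    exact (Category.assoc _ _ _).trans
      ((congrArg (r t ≫ ·) (Category.assoc _ _ _)).trans this.symm))

lemma toGlue_glueDesc : toGlue W q r hr ≫ glueDesc W q r hr π p hp h = π := by
  ext t
  exact hp t.unop

lemma toBelow_glue (t : T) :
    toBelow (glue W q r hr) t = r t ≫ belowMap (toGlue W q r hr) t :=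
  below_hom_ext fun s hs => by
    rw [toBelow_belowπ]
    refine Eq.trans ?_ (Category.assoc _ _ _).symm
    exact (glue_map W q r hr hs).trans (congrArg (r t ≫ ·) (belowMap_belowπ (toGlue W q r hr) hs).symm)

end Glue

/-- Given `π : W ⟶ Y` and a set `S` of pairwise incomparable indices, one can replace `W_t`, `t ∈ S`,
so that `π` satisfies the condition of special maps there. -/
lemma exists_isSpecialAt_of_antichain {N M : MorphismProperty C} (hNM : N.HasFactorization M)
    {W Y : Tᵒᵖ ⥤ C} (π : W ⟶ Y) (S : Set T) (hS : ∀ t ∈ S, ∀ s < t, s ∉ S) :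
    ∃ (W' : Tᵒᵖ ⥤ C) (θ : W ⟶ W') (π' : W' ⟶ Y), θ ≫ π' = π ∧
      (∀ t ∉ S, IsIso (θ.app (op t))) ∧
      ∀ t ∈ S, N (θ.app (op t)) ∧ IsSpecialAt M π' t := by
  have key : ∀ t : T, ∃ (Q : C) (q : W.obj (op t) ⟶ Q) (r : Q ⟶ limit (belowIncl t ⋙ W))
      (p : Q ⟶ Y.obj (op t)) (_ : q ≫ r = toBelow W t) (_ : q ≫ p = π.app (op t))
      (hpr : p ≫ toBelow Y t = r ≫ belowMap π t), (t ∉ S → IsIso q) ∧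
      (t ∈ S → N q ∧ ∃ (P : C) (p' : P ⟶ Y.obj (op t)) (q' : P ⟶ limit (belowIncl t ⋙ W))
        (h : IsPullback p' q' (toBelow Y t) (belowMap π t)), M (h.lift p r hpr)) := by
    intro t
    by_cases ht : t ∈ S
    · have h := IsPullback.of_hasPullback (toBelow Y t) (belowMap π t)
      -- For `t ∈ S` the comparison map from `W_t` to the fibre product is factored, and `Q_t` is
      -- the middle object; outside `S` nothing changes.
      obtain ⟨F⟩ := hNM.nonempty_mapFactorizationData
        (h.lift (π.app (op t)) (toBelow W t) (toBelow_comp_belowMap π t))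
      refine ⟨F.Z, F.i, F.p ≫ pullback.snd _ _, F.p ≫ pullback.fst _ _, ?_, ?_, ?_,
        fun h' => (h' ht).elim, fun _ => ⟨F.hi, _, _, _, h, ?_⟩⟩
      · rw [← Category.assoc, F.fac, h.lift_snd]
      · rw [← Category.assoc, F.fac, h.lift_fst]
      · rw [Category.assoc, Category.assoc, h.w]
      · have : h.lift (F.p ≫ pullback.fst _ _) (F.p ≫ pullback.snd _ _)
            (by rw [Category.assoc, Category.assoc, h.w]) = F.p :=
          h.hom_ext (h.lift_fst _ _ _) (h.lift_snd _ _ _)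
        rw [this]
        exact F.hp
    · exact ⟨_, 𝟙 _, toBelow W t, π.app (op t), Category.id_comp _, Category.id_comp _,
        toBelow_comp_belowMap π t, fun _ => inferInstance, fun h => (ht h).elim⟩
  choose Q q r p hr hp hpr hiso hfac using key
  refine ⟨glue W q r hr, toGlue W q r hr, glueDesc W q r hr π p hp hpr,
    toGlue_glueDesc W q r hr π p hp hpr, hiso, fun t ht => ⟨(hfac t ht).1, ?_⟩⟩
  obtain ⟨P, p', q', h, hM⟩ := (hfac t ht).2
  have h' : IsPullback p' q' (toBelow Y t)
      (belowMap (toGlue W q r hr ≫ glueDesc W q r hr π p hp hpr) t) := by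
    rwa [toGlue_glueDesc]
  -- No element below `t` lies in `S`, so the diagram below `t` is unchanged up to isomorphism and
  -- the old fibre product is still valid.
  refine isSpecialAt_of_isPullback (toGlue W q r hr) (fun s hs => hiso s (hS t ht s hs)) h'
    (Iso.refl _) (h.lift (p t) (r t) (hpr t)) hM ?_ ?_
  · rw [Iso.refl_inv, Category.id_comp]
    exact h.lift_fst _ _ _
  · rw [Iso.refl_inv, Category.id_comp, ← Category.assoc, toBelow_glue]
    exact congrArg (· ≫ belowMap (toGlue W q r hr) t) (h.lift_snd _ _ _)

/-- A factorization of `φ` that is as required on the indices with fewer than `n` predecessors,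
and trivial on the others. -/
structure PartialFactorization (N M : MorphismProperty C) {X Y : Tᵒᵖ ⥤ C} (φ : X ⟶ Y) (n : ℕ) where
  /-- the intermediate diagram -/
  Z : Tᵒᵖ ⥤ C
  /-- the first factor -/
  ι : X ⟶ Z
  /-- the second factor -/
  π : Z ⟶ Y
  fac : ι ≫ π = φ
  left (t : T) : (Set.Iic t).ncard < n → N (ι.app (op t))
  right (t : T) : (Set.Iic t).ncard < n → IsSpecialAt M π t
  isIso (t : T) : n ≤ (Set.Iic t).ncard → IsIso (ι.app (op t))

namespace PartialFactorization

variable {N M : MorphismProperty C} {X Y : Tᵒᵖ ⥤ C} {φ : X ⟶ Y}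

variable (N M φ) in
/-- The trivial partial factorization. -/
def zero : PartialFactorization N M φ 0 where
  Z := X
  ι := 𝟙 X
  π := φ
  fac := Category.id_comp φ
  left _ h := (Nat.not_lt_zero _ h).elim
  right _ h := (Nat.not_lt_zero _ h).elim
  isIso _ _ := inferInstance

variable [N.RespectsIso] [M.RespectsIso]

/-- The indices with `(Set.Iic t).ncard = n` are pairwise incomparable, so they can be treated
simultaneously. On lower levels the new map `θ` is invertible, so the conditions already achieved
there persist. -/
lemma exists_succ (hNM : N.HasFactorization M) {n : ℕ} (F : PartialFactorization N M φ n) :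
    ∃ (F' : PartialFactorization N M φ (n + 1)) (θ : F.Z ⟶ F'.Z), F.ι ≫ θ = F'.ι ∧
      θ ≫ F'.π = F.π ∧ ∀ t : T, (Set.Iic t).ncard < n → IsIso (θ.app (op t)) := by
  obtain ⟨W, θ, π, hfac, hiso, h⟩ := exists_isSpecialAt_of_antichain hNM F.π
    {t : T | (Set.Iic t).ncard = n} (fun t ht s hs hs' =>
      ((CofinitePoset.ncard_Iic_strictMono T hs).trans_eq (ht.trans hs'.symm)).false)
  refine ⟨⟨W, F.ι ≫ θ, π, by rw [Category.assoc, hfac, F.fac], fun t ht => ?_, fun t ht => ?_,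
    fun t ht => ?_⟩, θ, rfl, hfac, fun t ht => hiso t ht.ne⟩
  · rw [NatTrans.comp_app]
    obtain ht | ht := (Nat.lt_succ_iff_lt_or_eq.1 ht)
    · have := hiso t ht.ne
      exact (N.cancel_right_of_respectsIso _ _).2 (F.left t ht)
    · have := F.isIso t ht.ge
      exact (N.cancel_left_of_respectsIso _ _).2 (h t ht).1
  · obtain ht | ht := (Nat.lt_succ_iff_lt_or_eq.1 ht)
    · refine IsSpecialAt.of_isIso θ (fun s hs => hiso s ?_) (by rw [hfac]; exact F.right t ht)
      exact (((CofinitePoset.ncard_Iic_strictMono T).monotone hs).trans_lt ht).ne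
    · exact (h t ht).2
  · have := F.isIso t (Nat.le_of_succ_le ht)
    have := hiso t (Nat.lt_of_succ_le ht).ne'
    rw [NatTrans.comp_app]
    infer_instance

end PartialFactorization

/-- Every natural transformation factors as a levelwise `N`-map followed by a special `M`-map. -/
lemma exists_isLevelwise_comp_isSpecial {N M : MorphismProperty C} [N.RespectsIso] [M.RespectsIso]
    (hNM : N.HasFactorization M) {X Y : Tᵒᵖ ⥤ C} (φ : X ⟶ Y) :
    ∃ (Z : Tᵒᵖ ⥤ C) (ι : X ⟶ Z) (π : Z ⟶ Y), ι ≫ π = φ ∧ (∀ t, N (ι.app t)) ∧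
      IsSpecial M π := by
  let S : ∀ n, PartialFactorization N M φ n :=
    Nat.rec (PartialFactorization.zero N M φ) (fun _ F => (F.exists_succ hNM).choose)
  have hS : ∀ n, ∃ θ : (S n).Z ⟶ (S (n + 1)).Z, (S n).ι ≫ θ = (S (n + 1)).ι ∧
      θ ≫ (S (n + 1)).π = (S n).π ∧
      ∀ t : T, (Set.Iic t).ncard < n → IsIso (θ.app (op t)) := fun n =>
    ((S n).exists_succ hNM).choose_spec
  choose θ hι hπ hθ using hS
  let F : ℕ ⥤ Tᵒᵖ ⥤ C := Functor.ofSequence θ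
  have hF : ∀ n, F.map (homOfLE (Nat.le_add_right n 1)) = θ n :=
    Functor.ofSequence_map_homOfLE_succ θ
  -- Stage `n` settles the indices with `ncard < n`, so the value at `t` is final from stage `ncard
  -- + 1` on. This is why the colimit exists although `C` is only assumed to have finite limits.
  have hconst : ∀ t : T, (F.flip.obj (op t)).IsEventuallyConstantFrom ((Set.Iic t).ncard + 1) := by
    intro t j k
    obtain ⟨j, rfl⟩ := Nat.exists_eq_add_of_le k.le
    induction j with
    | zero =>
      obtain rfl : k = 𝟙 _ := Subsingleton.elim _ _
      infer_instance
    | succ j ih =>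
      have h₁ := ih (homOfLE (Nat.le_add_right _ _))
      have h₂ : IsIso ((F.flip.obj (op t)).map
          (homOfLE (Nat.le_add_right ((Set.Iic t).ncard + 1 + j) 1))) := by
        change IsIso ((F.map _).app (op t))
        rw [hF]
        exact hθ _ _ (by omega)
      obtain rfl : k = homOfLE (Nat.le_add_right _ j) ≫ homOfLE (Nat.le_add_right _ 1) :=
        Subsingleton.elim _ _
      rw [Functor.map_comp]
      infer_instance
  have : ∀ t, HasColimit (F.flip.obj t) := fun t => (hconst t.unop).hasColimit
  have hiso : ∀ (t : T), IsIso ((colimit.ι F ((Set.Iic t).ncard + 1)).app (op t)) := fun t =>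
    (hconst t).isIso_ι_of_isColimit
      (isColimitOfPreserves ((evaluation Tᵒᵖ C).obj (op t)) (colimit.isColimit F))
  have hiso' : ∀ (s t : T), s ≤ t →
      IsIso ((colimit.ι F ((Set.Iic t).ncard + 1)).app (op s)) := fun s t h =>
    (hconst s).isIso_ι_of_isColimit'
      (isColimitOfPreserves ((evaluation Tᵒᵖ C).obj (op s)) (colimit.isColimit F)) _
      (homOfLE (Nat.succ_le_succ ((CofinitePoset.ncard_Iic_strictMono T).monotone h)))
  let c : Cocone F :=
    { pt := Y
      ι := NatTrans.ofSequence (fun n => (S n).π) (fun n => by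
        rw [hF]
        exact (hπ n).trans (Category.comp_id _).symm) }
  have hdesc : ∀ n, colimit.ι F n ≫ colimit.desc F c = (S n).π := fun n => colimit.ι_desc c n
  have hι' : ∀ n, (S n).ι ≫ colimit.ι F n = (S 0).ι ≫ colimit.ι F 0 := by
    intro n
    induction n with
    | zero => rfl
    | succ n ih =>
      rw [← ih, ← colimit.w F (homOfLE (Nat.le_add_right n 1)), hF, ← hι n]
      exact Category.assoc _ _ _
  refine ⟨colimit F, (S 0).ι ≫ colimit.ι F 0, colimit.desc F c, ?_, fun t => ?_, fun t => ?_⟩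
  · exact (Category.assoc _ _ _).trans ((congrArg ((S 0).ι ≫ ·) (hdesc 0)).trans (S 0).fac)
  · rw [← hι' ((Set.Iic t.unop).ncard + 1)]
    let j : (S ((Set.Iic t.unop).ncard + 1)).Z ⟶ colimit F :=
      colimit.ι F ((Set.Iic t.unop).ncard + 1)
    have : IsIso (j.app t) := hiso t.unop
    exact MorphismProperty.RespectsIso.postcomp N (j.app t) _
      ((S _).left t.unop (Nat.lt_succ_self _))
  · refine IsSpecialAt.of_isIso (colimit.ι F ((Set.Iic t).ncard + 1)) (fun s hs => hiso' s t hs) ?_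
    rw [hdesc]
    exact (S _).right t (Nat.lt_succ_self _)

/-- A special map for the closure of `M` under isomorphisms is isomorphic to a special `M`-map. -/
lemma exists_isSpecial_of_isoClosure {M : MorphismProperty C} {X Y : Tᵒᵖ ⥤ C} {φ : X ⟶ Y}
    (h : IsSpecial M.isoClosure φ) :
    ∃ (X' : Tᵒᵖ ⥤ C) (a : X ≅ X'), IsSpecial M (a.inv ≫ φ) := by
  choose P p q hpb A B f hf e using h
  let a (t : Tᵒᵖ) : X.obj t ≅ A t.unop := (Arrow.leftFunc.mapIso (e t.unop).some).symm
  let b (t : T) : P t ≅ B t := (Arrow.rightFunc.mapIso (e t).some).symm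
  have hab : ∀ t : T, f t ≫ (b t).inv = (a (op t)).inv ≫ (hpb t).lift (φ.app (op t)) (toBelow X t)
    (toBelow_comp_belowMap φ t) := fun t => (e t).some.hom.w.symm
  let α := X.isoCopyObj (fun t => A t.unop) a
  refine ⟨_, α, fun t => ?_⟩
  have h' : IsPullback (p t) (q t) (toBelow Y t) (belowMap (α.hom ≫ α.inv ≫ φ) t) := by
    rw [Iso.hom_inv_id_assoc]
    exact hpb t
  refine isSpecialAt_of_isPullback α.hom (fun s _ => inferInstance) h' (b t) (f t) (hf t) ?_ ?_
  · have h₁ : f t ≫ (b t).inv ≫ p t = (a (op t)).inv ≫ φ.app (op t) := by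
      rw [← Category.assoc, hab, Category.assoc, (hpb t).lift_fst]
    exact h₁
  · have h₁ : f t ≫ (b t).inv ≫ q t = (a (op t)).inv ≫ toBelow X t := by
      rw [← Category.assoc, hab, Category.assoc, (hpb t).lift_snd]
    have h₂ : f t ≫ (b t).inv ≫ q t ≫ belowMap α.hom t =
        (a (op t)).inv ≫ toBelow X t ≫ belowMap α.hom t := by
      rw [← Category.assoc (b t).inv, ← Category.assoc, h₁, Category.assoc]
    exact h₂.trans ((congrArg ((a (op t)).inv ≫ ·) (toBelow_comp_belowMap α.hom t).symm).trans
      (Iso.inv_hom_id_assoc (a (op t)) _))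

end Special

namespace CategoryTheory.MorphismProperty

lemma HasFactorization.isoClosure {C : Type*} [Category* C] {N M : MorphismProperty C}
    (h : N.HasFactorization M) : N.isoClosure.HasFactorization M.isoClosure where
  nonempty_mapFactorizationData f := by
    obtain ⟨F⟩ := h.nonempty_mapFactorizationData f
    exact ⟨⟨F.Z, F.i, F.p, F.fac, N.le_isoClosure _ F.hi, M.le_isoClosure _ F.hp⟩⟩

end CategoryTheory.MorphismProperty

/-! ### Factorization in the cofinite model -/

namespace BarPro

variable {C : Type u} [Category.{v} C]

section

variable {A : Type w} [PartialOrder A] [CofinitePoset A] [Nonempty A] [IsDirectedOrder A]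
  [NoMaxOrder A]

lemma ofNatTrans_comp {X Y Z : Aᵒᵖ ⥤ C} (φ : X ⟶ Y) (ψ : Y ⟶ Z) :
    ofNatTrans (φ ≫ ψ) = ofNatTrans φ ≫ ofNatTrans ψ := rfl

lemma ofNatTrans_id (X : Aᵒᵖ ⥤ C) : ofNatTrans (𝟙 X) = 𝟙 (of X) := rfl

/-- An isomorphism of diagrams induces an isomorphism. -/
def ofNatIso {X Y : Aᵒᵖ ⥤ C} (e : X ≅ Y) : of X ≅ of Y where
  hom := ofNatTrans e.hom
  inv := ofNatTrans e.inv
  hom_inv_id := by rw [← ofNatTrans_comp, e.hom_inv_id, ofNatTrans_id]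
  inv_hom_id := by rw [← ofNatTrans_comp, e.inv_hom_id, ofNatTrans_id]

/-- Conjugation by isomorphisms of diagrams does not change the isomorphism class of arrows. -/
def arrowIsoOfNatIso {X Y X' Y' : Aᵒᵖ ⥤ C} (φ : X ⟶ Y) (a : X ≅ X') (b : Y ≅ Y') :
    Arrow.mk (ofNatTrans φ) ≅ Arrow.mk (ofNatTrans (a.inv ≫ φ ≫ b.hom)) :=
  Arrow.isoMk (ofNatIso a) (ofNatIso b) (by
    change ofNatTrans a.hom ≫ ofNatTrans (a.inv ≫ φ ≫ b.hom) = ofNatTrans φ ≫ ofNatTrans b.hom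
    rw [← ofNatTrans_comp, ← ofNatTrans_comp, Iso.hom_inv_id_assoc])

end

instance (N : MorphismProperty C) : (LwInternal.{w} N).RespectsIso :=
  MorphismProperty.RespectsIso.of_respects_arrow_iso _ (by
    rintro f g e ⟨A, i₁, i₂, i₃, i₄, i₅, X, Y, φ, hφ, ⟨e'⟩⟩
    exact ⟨A, i₁, i₂, i₃, i₄, i₅, X, Y, φ, hφ, ⟨e.symm ≪≫ e'⟩⟩)

lemma LwInternal_le_Lw (N : MorphismProperty C) : LwInternal.{w} N ≤ Lw.{w} N := by
  rintro X Y f ⟨A, _, _, _, _, _, X', Y', φ, hφ, ⟨e⟩⟩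
  exact ⟨_, inferInstance, inferInstance, _, _, φ, hφ, ⟨(toPro C).mapArrow.mapIso e⟩⟩

variable [HasFiniteLimits C]

lemma SpInternal_le_Sp (M : MorphismProperty C) : SpInternal.{w} M ≤ Sp.{w} M := by
  rintro X Y f ⟨A, _, _, _, _, _, X', Y', φ, hφ, ⟨e⟩⟩
  exact ⟨_, inferInstance, inferInstance, inferInstance, inferInstance, _, _, φ, hφ,
    ⟨(toPro C).mapArrow.mapIso e⟩⟩

/-- The construction needs classes closed under isomorphism, so it is run for the isomorphism
closures. The two factors are then corrected separately, with different copies of the middle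
diagram; this is harmless because the target classes are defined up to isomorphism of arrows. -/
lemma hasFactorization_internal {N M : MorphismProperty C} (hNM : N.HasFactorization M) :
    (LwInternal.{w} N).HasFactorization (SpInternal.{w} M) where
  nonempty_mapFactorizationData {F G} f := by
    obtain ⟨A, i₁, i₂, i₃, i₄, i₅, X, Y, φ, ⟨e⟩⟩ := exists_arrow_iso_ofNatTrans f
    obtain ⟨Z, ι, π, hφ, hι, hπ⟩ := exists_isLevelwise_comp_isSpecial hNM.isoClosure φ
    obtain ⟨X₁, Z₁, a, b, hι'⟩ := exists_isLevelwise_of_isoClosure hι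
    obtain ⟨Z₂, c, hπ'⟩ := exists_isSpecial_of_isoClosure hπ
    let l : F ≅ of X := Arrow.leftFunc.mapIso e
    let r : G ≅ of Y := Arrow.rightFunc.mapIso e
    have w : l.hom ≫ ofNatTrans φ = f ≫ r.hom := e.hom.w
    refine ⟨⟨of Z, l.hom ≫ ofNatTrans ι, ofNatTrans π ≫ r.inv, ?_, ?_, ?_⟩⟩
    · rw [Category.assoc, ← Category.assoc (ofNatTrans ι), ← ofNatTrans_comp, hφ,
        ← Category.assoc, w, Category.assoc, r.hom_inv_id, Category.comp_id]
    · let e' : Arrow.mk (l.hom ≫ ofNatTrans ι) ≅ Arrow.mk (ofNatTrans ι) :=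
        Arrow.isoMk l (Iso.refl _) (Category.comp_id _).symm
      exact ⟨A, i₁, i₂, i₃, i₄, i₅, X₁, Z₁, _, hι', ⟨e' ≪≫ arrowIsoOfNatIso ι a b⟩⟩
    · let e' : Arrow.mk (ofNatTrans π ≫ r.inv) ≅ Arrow.mk (ofNatTrans π) :=
        Arrow.isoMk (Iso.refl _) r (by simp)
      have hπ'' : IsSpecial M (c.inv ≫ π ≫ (Iso.refl Y).hom) := by
        rwa [Iso.refl_hom, Category.comp_id]
      exact ⟨A, i₁, i₂, i₃, i₄, i₅, Z₂, Y, _, hπ'', ⟨e' ≪≫ arrowIsoOfNatIso π c (Iso.refl _)⟩⟩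

end BarPro

/-! ### Maps with the lifting property are levelwise `N`-maps -/

/-- The poset obtained from `A` by requiring that `a < b` only if `α a ≤ b`. -/
def Sparse {A : Type w} [PartialOrder A] {α : A → A} (_ : ∀ a, a < α a) : Type w := A

namespace Sparse

variable {A : Type w} [PartialOrder A] {α : A → A} {hα : ∀ a, a < α a}

/-- The element of `A`. -/
def val (x : Sparse hα) : A := x

variable (hα) in
/-- An element of `A` as an element of the sparser poset. -/
def mk (a : A) : Sparse hα := a

/-- Only `a < α a` is needed here; `α` need not be monotone. -/
instance : PartialOrder (Sparse hα) where
  le x y := x = y ∨ α x.val ≤ y.val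
  le_refl x := Or.inl rfl
  le_trans x y z := by
    rintro (rfl | h) (rfl | h')
    · exact Or.inl rfl
    · exact Or.inr h'
    · exact Or.inr h
    · exact Or.inr (h.trans ((hα _).le.trans h'))
  le_antisymm x y := by
    rintro (rfl | h) (h' | h')
    · rfl
    · rfl
    · exact h'.symm
    · exact (((hα _).trans_le h).trans ((hα _).trans_le h')).false.elim

lemma lt_iff {x y : Sparse hα} : x < y ↔ α x.val ≤ y.val := by
  constructor
  · intro h
    exact h.le.resolve_left h.ne
  · intro h
    refine lt_of_le_of_ne (Or.inr h) ?_
    rintro rfl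
    exact ((hα _).trans_le h).false

lemma val_mono : Monotone (val : Sparse hα → A) := by
  rintro x y (rfl | h)
  · exact le_rfl
  · exact (hα _).le.trans h

instance [CofinitePoset A] : CofinitePoset (Sparse hα) where
  finite_Iic x := (CofinitePoset.finite_Iic x.val).subset fun _ h => val_mono h

instance [Nonempty A] : Nonempty (Sparse hα) := ‹Nonempty A›

instance [IsDirectedOrder A] : IsDirectedOrder (Sparse hα) where
  directed x y := by
    obtain ⟨c, h, h'⟩ := exists_ge_ge (α x.val) (α y.val)
    exact ⟨c, Or.inr h, Or.inr h'⟩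

instance : NoMaxOrder (Sparse hα) where
  exists_gt x := ⟨mk hα (α x.val), lt_iff.2 le_rfl⟩

lemma exists_le_val (a : A) : ∃ x : Sparse hα, a ≤ x.val := ⟨mk hα a, le_rfl⟩

end Sparse

section Interpolation

variable {C : Type u} [Category.{v} C] {A : Type w} [PartialOrder A] {α : A → A}
  (hα : ∀ a, a < α a) {X Y : Aᵒᵖ ⥤ C} (φ : X ⟶ Y) {Z : A → C}
  (i : ∀ a, X.obj (op a) ⟶ Z a) (p : ∀ a, Z a ⟶ Y.obj (op a))
  (hip : ∀ a, i a ≫ p a = φ.app (op a)) (g : ∀ a, Y.obj (op (α a)) ⟶ Z a)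
  (hig : ∀ a, φ.app (op (α a)) ≫ g a = X.map (homOfLE (hα a).le).op ≫ i a)
  (hgp : ∀ a, g a ≫ p a = Y.map (homOfLE (hα a).le).op)

-- The middle stretch `Y_{α s} ⟶ Z_s ⟶ Y_s` is a transition map of `Y` by `hgp`.
include hgp in
lemma interpolation_comp {t s l : Sparse hα} (h : s < t) (h' : l < s) :
    (p t.val ≫ Y.map (homOfLE (Sparse.lt_iff.1 h)).op ≫ g s.val) ≫
        p s.val ≫ Y.map (homOfLE (Sparse.lt_iff.1 h')).op ≫ g l.val =
      p t.val ≫ Y.map (homOfLE (Sparse.lt_iff.1 (h'.trans h))).op ≫ g l.val := by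
  rw [Category.assoc, Category.assoc, ← Category.assoc (g _), hgp,
    Functor.map_homOfLE_comp_map_assoc, Functor.map_homOfLE_comp_map_assoc]

/-- The diagram of the objects `Z_a` with the transition maps `Z_b ⟶ Y_b ⟶ Y_{α a} ⟶ Z_a`. -/
noncomputable def interpolation : (Sparse hα)ᵒᵖ ⥤ C :=
  functorOfLT (Q := fun x : Sparse hα => Z x.val)
    (fun {t s} h => p t.val ≫ Y.map (homOfLE (Sparse.lt_iff.1 h)).op ≫ g s.val)
    (interpolation_comp hα p g hgp)

lemma interpolation_map {t s : Sparse hα} (h : s < t) :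
    (interpolation hα p g hgp).map (homOfLE h.le).op =
      p t.val ≫ Y.map (homOfLE (Sparse.lt_iff.1 h)).op ≫ g s.val :=
  functorOfLT_map _ (interpolation_comp hα p g hgp) h

/-- The natural transformation with components `X_a ⟶ Z_a`. -/
noncomputable def toInterpolation :
    Sparse.val_mono.functor.op ⋙ X ⟶ interpolation hα p g hgp :=
  natTransOfLT (F := Sparse.val_mono.functor.op ⋙ X) (G := interpolation hα p g hgp)
    (fun x => i x.val) (fun {t s} h => by
      have e : X.map (homOfLE (Sparse.val_mono h.le)).op ≫ i s.val =
          i t.val ≫ p t.val ≫ Y.map (homOfLE (Sparse.lt_iff.1 h)).op ≫ g s.val := by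
        rw [← Category.assoc, hip, ← NatTrans.naturality_assoc, hig,
          Functor.map_homOfLE_comp_map_assoc]
      exact e.trans (congrArg (i t.val ≫ ·) (interpolation_map hα p g hgp h).symm))

/-- The natural transformation with components `Z_a ⟶ Y_a`. -/
noncomputable def interpolationDesc :
    interpolation hα p g hgp ⟶ Sparse.val_mono.functor.op ⋙ Y :=
  natTransOfLT (F := interpolation hα p g hgp) (G := Sparse.val_mono.functor.op ⋙ Y)
    (fun x => p x.val) (fun {t s} h => by
      have e : (p t.val ≫ Y.map (homOfLE (Sparse.lt_iff.1 h)).op ≫ g s.val) ≫ p s.val =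
          p t.val ≫ Y.map (homOfLE (Sparse.val_mono h.le)).op := by
        rw [Category.assoc, Category.assoc, hgp, Functor.map_homOfLE_comp_map]
      exact (congrArg (· ≫ p s.val) (interpolation_map hα p g hgp h)).trans e)

lemma toInterpolation_interpolationDesc :
    toInterpolation hα φ i p hip g hig hgp ≫ interpolationDesc hα p g hgp =
      Functor.whiskerLeft Sparse.val_mono.functor.op φ := by
  ext x
  exact hip _

/-- The objects `Z_a` form a pro-object isomorphic to `Y`. -/
noncomputable def interpolationIso [Nonempty A] [IsDirectedOrder A] :
    ProObj.of (interpolation hα p g hgp) ≅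
      ProObj.of ((Sparse.val_mono (hα := hα)).functor.op ⋙ Y) where
  hom := ProObj.ofNatTrans (interpolationDesc hα p g hgp)
  -- The inverse is represented by the diagonals `g : Y_{α x} ⟶ Z_x`, so each composite with the
  -- maps `p` is a transition map from `α x` to `x`.
  inv := ProObj.Hom.mk (fun x => ProObj.ColimHom.mk
      (X := ProObj.of ((Sparse.val_mono (hα := hα)).functor.op ⋙ Y))
      (op (Sparse.mk hα (α x.unop.val))) (g x.unop.val)) (fun {t s} k => by
    obtain heq | hlt := k.unop.le.eq_or_lt
    · obtain rfl : s = t := Opposite.unop_injective heq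
      obtain rfl : k = 𝟙 _ := Subsingleton.elim _ _
      exact (congrArg (fun f => ProObj.ColimHom.postcomp f _)
        ((interpolation hα p g hgp).map_id s)).trans (ProObj.ColimHom.postcomp_id _)
    · obtain rfl : k = (homOfLE hlt.le).op := Subsingleton.elim _ _
      have hle := Sparse.lt_iff.1 hlt
      have h₁ : g t.unop.val ≫ p t.unop.val ≫ Y.map (homOfLE hle).op ≫ g s.unop.val =
          Y.map (homOfLE (hle.trans (hα _).le)).op ≫ g s.unop.val := by
        rw [← Category.assoc, hgp, Functor.map_homOfLE_comp_map_assoc]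
      refine (congrArg (fun f => ProObj.ColimHom.mk
        (X := ProObj.of ((Sparse.val_mono (hα := hα)).functor.op ⋙ Y)) _ (g t.unop.val ≫ f))
        (interpolation_map hα p g hgp hlt)).trans ?_
      refine (congrArg (ProObj.ColimHom.mk _) h₁).trans ?_
      refine (congrArg (ProObj.ColimHom.postcomp (g s.unop.val))
        (ProObj.mk_reindex_eq Sparse.val_mono Y (d := Sparse.mk hα (α t.unop.val))
          (d' := Sparse.mk hα (α s.unop.val)) (i := α s.unop.val)
          (hle.trans (hα _).le) le_rfl)).trans ?_
      refine congrArg (ProObj.ColimHom.mk _) ?_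
      exact (congrArg (· ≫ g s.unop.val) (Y.map_id _)).trans (Category.id_comp _))
  hom_inv_id := ProObj.hom_ext fun x => by
    have hlt : x.unop < Sparse.mk hα (α x.unop.val) := Sparse.lt_iff.2 le_rfl
    refine Eq.trans ?_ (ProObj.ColimHom.mk_restrict (X := ProObj.of (interpolation hα p g hgp))
      (homOfLE hlt.le).op (𝟙 _))
    refine congrArg (ProObj.ColimHom.mk _) ?_
    refine Eq.trans ?_ (Category.comp_id _).symm
    refine Eq.trans ?_ (interpolation_map hα p g hgp hlt).symm
    refine congrArg (p _ ≫ ·) ?_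
    exact ((congrArg (· ≫ g _) (Y.map_id _)).trans (Category.id_comp _)).symm
  inv_hom_id := ProObj.hom_ext fun x => by
    have hlt : x.unop < Sparse.mk hα (α x.unop.val) := Sparse.lt_iff.2 le_rfl
    refine Eq.trans ?_ (ProObj.ColimHom.mk_restrict
      (X := ProObj.of ((Sparse.val_mono (hα := hα)).functor.op ⋙ Y)) (homOfLE hlt.le).op (𝟙 _))
    refine congrArg (ProObj.ColimHom.mk _) ?_
    exact (hgp _).trans (Category.comp_id _).symm

end Interpolation

namespace BarPro

variable {C : Type u} [Category.{v} C]

/-- Factor `φ_a` as `i` followed by `p` in `M`. The square with sides `φ` and `p`, given by `i` on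
`X_a` and the identity on `Y_a`, has a lift `Y ⟶ Z`; it is represented by some `g`, and at a late
enough index both triangles commute strictly. -/
lemma exists_interpolation_of_ofBase_llp {N M : MorphismProperty C}
    (hNM : N.HasFactorization M) {A : Type w} [PartialOrder A] [Nonempty A] [IsDirectedOrder A]
    [NoMaxOrder A] {X Y : Aᵒᵖ ⥤ C} {φ : X ⟶ Y}
    (hφ : (ProObj.ofBase.{w} M).llp (ProObj.ofNatTrans φ)) (a : A) :
    ∃ (b : A) (hb : a < b) (Z : C) (i : X.obj (op a) ⟶ Z) (p : Z ⟶ Y.obj (op a))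
      (g : Y.obj (op b) ⟶ Z), N i ∧ i ≫ p = φ.app (op a) ∧
      φ.app (op b) ≫ g = X.map (homOfLE hb.le).op ≫ i ∧ g ≫ p = Y.map (homOfLE hb.le).op := by
  obtain ⟨F⟩ := hNM.nonempty_mapFactorizationData (φ.app (op a))
  have hlift := (ProObj.ofBase_llp_iff M _).1 hφ F.p F.hp
  rw [ProObj.hasLiftingProperty_simple_map_iff] at hlift
  obtain ⟨z, h₁, h₂⟩ := hlift (ProObj.ColimHom.mk (X := ProObj.of X) (op a) F.i)
    (ProObj.ColimHom.mk (X := ProObj.of Y) (op a) (𝟙 _)) (by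
      change ProObj.ColimHom.mk (X := ProObj.of X) (op a) (F.i ≫ F.p) =
        ProObj.ColimHom.mk (X := ProObj.of X) (op a) (φ.app (op a) ≫ 𝟙 _)
      rw [F.fac, Category.comp_id])
  obtain ⟨⟨b⟩, g, rfl⟩ := z.exists_rep
  obtain ⟨⟨c⟩, k₁, l₁, e₁⟩ := (ProObj.ColimHom.mk_eq_mk_iff (X := ProObj.of X)
    (φ.app (op b) ≫ g) F.i).1 h₁
  obtain ⟨⟨d⟩, k₂, l₂, e₂⟩ := (ProObj.ColimHom.mk_eq_mk_iff (X := ProObj.of Y)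
    (g ≫ F.p) (𝟙 (Y.obj (op a)))).1 h₂
  have hbc : b ≤ c := k₁.unop.le
  have hac : a ≤ c := l₁.unop.le
  have hbd : b ≤ d := k₂.unop.le
  have had : a ≤ d := l₂.unop.le
  obtain ⟨s, hc, hd⟩ := exists_ge_ge c d
  -- The index is pushed strictly above `a`, as the thinned-out order requires `a < α a`.
  obtain ⟨t, ht⟩ := exists_gt s
  have hct : c ≤ t := hc.trans ht.le
  have hdt : d ≤ t := hd.trans ht.le
  refine ⟨t, (hac.trans hc).trans_lt ht, F.Z, F.i, F.p,
    Y.map (homOfLE (hbc.trans hct)).op ≫ g, F.hi, F.fac, ?_, ?_⟩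
  · have e₁' : X.map (homOfLE hbc).op ≫ φ.app (op b) ≫ g = X.map (homOfLE hac).op ≫ F.i := e₁
    rw [← NatTrans.naturality_assoc, ← Functor.map_homOfLE_comp_map_assoc X hbc hct, e₁',
      Functor.map_homOfLE_comp_map_assoc]
  · have e₂' : Y.map (homOfLE hbd).op ≫ g ≫ F.p = Y.map (homOfLE had).op ≫ 𝟙 _ := e₂
    rw [Category.assoc, ← Functor.map_homOfLE_comp_map_assoc Y hbd hdt, e₂', Category.comp_id,
      Functor.map_homOfLE_comp_map]

/-- The first factor `X ⟶ Z` of the interpolation is levelwise in `N`, and the second factor `Z ⟶ Y`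
is an isomorphism of pro-objects, so `φ` is isomorphic to the first. -/
lemma ofBase_llp_le_LwInternal {N M : MorphismProperty C} (hNM : N.HasFactorization M) :
    (ofBase.{w} M).llp ≤ LwInternal.{w} N := by
  intro F G f hf
  obtain ⟨A, _, _, _, _, _, X, Y, φ, ⟨e⟩⟩ := exists_arrow_iso_ofNatTrans f
  have hφ : (ofBase.{w} M).llp (ofNatTrans φ) :=
    (MorphismProperty.arrow_mk_iso_iff (ofBase.{w} M).llp e).1 hf
  have hφ' : (ProObj.ofBase.{w} M).llp (ProObj.ofNatTrans φ) := ofBase_llp_iff.1 hφ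
  choose α hα Z i p g hi hip hig hgp using exists_interpolation_of_ofBase_llp hNM hφ'
  refine ⟨Sparse hα, inferInstance, inferInstance, inferInstance, inferInstance, inferInstance,
    _, _, toInterpolation hα φ i p hip g hig hgp, fun x => hi _, ⟨e ≪≫ arrowIsoOfToPro ?_⟩⟩
  let e' : Arrow.mk (ProObj.ofNatTrans (toInterpolation hα φ i p hip g hig hgp)) ≅
      Arrow.mk (ProObj.ofNatTrans
        (Functor.whiskerLeft (Sparse.val_mono (hα := hα)).functor.op φ)) :=
    Arrow.isoMk (Iso.refl _) (interpolationIso hα p g hgp) (by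
      change 𝟙 _ ≫ _ = ProObj.ofNatTrans (toInterpolation hα φ i p hip g hig hgp) ≫
        ProObj.ofNatTrans (interpolationDesc hα p g hgp)
      rw [Category.id_comp]
      exact congrArg ProObj.ofNatTrans
        (toInterpolation_interpolationDesc hα φ i p hip g hig hgp).symm)
  exact ProObj.reindexArrowIso (Sparse.val_mono (hα := hα)) Sparse.exists_le_val φ ≪≫ e'.symm

/-! ### Weak factorization systems -/

variable [HasFiniteLimits C]

/-- The bounds on `L` and `R` cover both descriptions of the classes at once. The chain from
`LwInternal N` through `L` and `Lw N` to `⊥M` and back to `LwInternal N` forces equality, so `L =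
⊥M` is closed under retracts. -/
lemma isWeakFactorizationSystem_of_le {N M : MorphismProperty C} (hNM : N.HasFactorization M)
    (h : N ≤ M.llp) {L R : MorphismProperty (BarPro.{w} C)} (hL : LwInternal.{w} N ≤ L)
    (hL' : L ≤ Lw.{w} N) (hR : SpInternal.{w} M ≤ R) (hR' : R ≤ Sp.{w} M) :
    L.IsWeakFactorizationSystem R.retracts := by
  have hfac := hasFactorization_internal.{w} hNM
  have : L.HasFactorization R.retracts := ⟨fun f => by
    obtain ⟨F⟩ := hfac.nonempty_mapFactorizationData f
    exact ⟨⟨F.Z, F.i, F.p, F.fac, hL _ F.hi, R.le_retracts _ (hR _ F.hp)⟩⟩⟩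
  have hle : L ≤ (ofBase.{w} M).llp := hL'.trans (Lw_le_ofBase_llp h)
  have heq : L = (ofBase.{w} M).llp := le_antisymm hle ((ofBase_llp_le_LwInternal hNM).trans hL)
  have : L.IsStableUnderRetracts := by
    rw [heq]
    infer_instance
  have : R.retracts.IsStableUnderRetracts := by
    rw [MorphismProperty.isStableUnderRetracts_iff_retracts_le]
    rintro X Y f ⟨_, _, g, r, _, _, k, r', hk⟩
    exact ⟨_, _, k, Retract.trans r r', hk⟩
  -- By the retract argument, factorization and closure under retracts leave only the lifting
  -- property to check.
  refine .mk' _ _ fun i p hi hp => ?_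
  have hi' : R.retracts.llp i := by
    rw [MorphismProperty.llp_retracts]
    refine MorphismProperty.antitone_llp hR' _ ?_
    rw [Sp_llp_eq]
    exact hle _ hi
  exact hi' p hp

end BarPro

theorem propositionp {C : Type u} [Category.{v} C] [HasFiniteLimits C]
    (N M : MorphismProperty C) :
    -- (1), in `Pro(C)` and in its model indexed by cofinite directed sets of infinite height
    (((ProObj.Sp.{w} M).retracts.llp = (ProObj.Sp.{w} M).llp ∧
        (ProObj.Sp.{w} M).llp = (ProObj.ofBase.{w} M).llp) ∧
      ((BarPro.Sp.{w} M).retracts.llp = (BarPro.Sp.{w} M).llp ∧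
        (BarPro.Sp.{w} M).llp = (BarPro.ofBase.{w} M).llp)) ∧
    -- (2), for both descriptions of the classes
    (N.HasFactorization M →
      (BarPro.Lw.{w} N).HasFactorization (BarPro.Sp.{w} M) ∧
        (BarPro.LwInternal.{w} N).HasFactorization (BarPro.SpInternal.{w} M)) ∧
    -- (3), for both descriptions of the classes
    (N.HasFactorization M → N ≤ M.llp →
      (BarPro.Lw.{w} N).IsWeakFactorizationSystem (BarPro.Sp.{w} M).retracts ∧
        (BarPro.LwInternal.{w} N).IsWeakFactorizationSystem (BarPro.SpInternal.{w} M).retracts) := by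
  refine ⟨⟨⟨MorphismProperty.llp_retracts _, ProObj.Sp_llp_eq M⟩,
    MorphismProperty.llp_retracts _, BarPro.Sp_llp_eq M⟩, fun hNM => ?_, fun hNM h => ?_⟩
  · have hfac := BarPro.hasFactorization_internal.{w} hNM
    refine ⟨⟨fun f => ?_⟩, hfac⟩
    obtain ⟨F⟩ := hfac.nonempty_mapFactorizationData f
    exact ⟨⟨F.Z, F.i, F.p, F.fac, BarPro.LwInternal_le_Lw N _ F.hi,
      BarPro.SpInternal_le_Sp M _ F.hp⟩⟩
  · exact ⟨BarPro.isWeakFactorizationSystem_of_le hNM h (BarPro.LwInternal_le_Lw N) le_rfl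
      (BarPro.SpInternal_le_Sp M) le_rfl,
      BarPro.isWeakFactorizationSystem_of_le hNM h le_rfl (BarPro.LwInternal_le_Lw N) le_rfl
        (BarPro.SpInternal_le_Sp M)⟩
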